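/- Let $\mathbb{F}$ be a finite field with $k$ elements, let $\mathcal{Z}=\mathbb{F}[X]$, and let $\mathcal{K}=\mathbb{F}((X^{-1}))$ be the field of formal Laurent series in $X^{-1}$, with the absolute value $|a|=k^{-v(a)}$, where $v(a)$ is the least exponent $i$ such that $X^{-i}$ occurs in $a$ (and $|0|=0$). Let $n\ge 0$ be an integer and let $$\Omega_{n+1}=\operatorname{SL}(n+1,\mathcal{K})/\operatorname{SL}(n+1,\mathcal{Z}),$$ with the quotient topology, where the coset of $g$ is identified with the unimodular lattice $g\mathcal{Z}^{n+1}\subset\mathcal{K}^{n+1}$. Equip $\Omega_{n+1}$ with the metric induced by the right-invariant metric $\min(1,\|gh^{-1}-I\|)$ on $\operatorname{SL}(n+1,\mathcal{K})$, where $\|\cdot\|$ is the maximum of the absolute values of the entries; that is, $d(\Lambda_1,\Lambda_2)=\min(1,\inf\{\|u-I\| : u\in \operatorname{SL}(n+1,\mathcal{K}),\ u\Lambda_1=\Lambda_2\})$, which induces the quotient topology. For $t\in\mathbb{Z}$ let $$g_t=\operatorname{diag}(X^{nt},X^{-t},\dots,X^{-t})\in\operatorname{SL}(n+1,\mathcal{K}).$$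 Then the set $$Bdd_{n+1}=\{\Lambda\in\Omega_{n+1} : \{g_t\Lambda : t\in\mathbb{Z},\ t\ge 0\}\text{ is contained in a compact subset of }\Omega_{n+1}\}$$ has full Hausdorff dimension: $\dim_H Bdd_{n+1}=\dim_H\Omega_{n+1}=(n+1)^2-1$. -/

import Mathlib

open scoped Matrix

namespace PosChar

/-- The field `𝔽((X⁻¹))` of formal Laurent series in `X⁻¹`. The variable of `LaurentSeries F` plays
the role of `X⁻¹`. (A type synonym, so that it can carry its absolute value as a norm.) -/
def KInf (F : Type*) [Field F] : Type _ := LaurentSeries F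

section Field

variable (F : Type*) [Field F]

noncomputable instance : Field (KInf F) := inferInstanceAs (Field (LaurentSeries F))

/-- The element `X` of `𝔽((X⁻¹))`, i.e. the inverse of the variable of `LaurentSeries F`. -/
noncomputable def KInf.X : KInf F := (HahnSeries.single (-1 : ℤ) (1 : F) : LaurentSeries F)

/-- The inclusion of the constants `𝔽` in `𝔽((X⁻¹))`. -/
noncomputable def KInf.C : F →+* KInf F := (HahnSeries.C : F →+* LaurentSeries F)

/-- The inclusion of the polynomial ring `𝔽[X]` in `𝔽((X⁻¹))`. -/
noncomputable def KInf.ofPoly : Polynomial F →+* KInf F :=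
  Polynomial.eval₂RingHom (KInf.C F) (KInf.X F)

variable {F}

/-- The valuation at infinity: the least exponent of `X⁻¹` that occurs (junk value `0` at `0`). -/
noncomputable def KInf.val (a : KInf F) : ℤ := HahnSeries.order (a : LaurentSeries F)

/-- The coefficient of `X⁻ⁱ`. -/
def KInf.coeff (a : KInf F) (i : ℤ) : F := HahnSeries.coeff (a : LaurentSeries F) i

lemma KInf.val_mul {a b : KInf F} (ha : a ≠ 0) (hb : b ≠ 0) : (a * b).val = a.val + b.val :=
  HahnSeries.order_mul (x := (a : LaurentSeries F)) (y := (b : LaurentSeries F)) ha hb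

lemma KInf.min_val_le {a b : KInf F} (h : a + b ≠ 0) : min a.val b.val ≤ (a + b).val :=
  HahnSeries.min_order_le_order_add (x := (a : LaurentSeries F)) (y := (b : LaurentSeries F)) h

lemma KInf.X_ne_zero : KInf.X F ≠ 0 :=
  HahnSeries.single_ne_zero (one_ne_zero)

lemma KInf.coeff_ofPoly (p : Polynomial F) (m : ℕ) :
    (KInf.ofPoly F p).coeff (-(m : ℤ)) = p.coeff m := by
  have hX : ∀ k : ℕ, ((KInf.X F) ^ k : KInf F) =
      (HahnSeries.single (-(k : ℤ)) (1 : F) : LaurentSeries F) := by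
    intro k
    have h := HahnSeries.single_pow (-1 : ℤ) k (1 : F)
    simp only [one_pow, smul_neg, nsmul_eq_mul, mul_one] at h
    exact h
  induction p using Polynomial.induction_on' with
  | add p q hp hq =>
    rw [map_add, Polynomial.coeff_add, ← hp, ← hq]
    exact HahnSeries.coeff_add
  | monomial k a =>
    have h1 : KInf.ofPoly F (Polynomial.monomial k a) =
        (HahnSeries.single (-(k : ℤ)) a : LaurentSeries F) := by
      have h2 : KInf.ofPoly F (Polynomial.monomial k a) = KInf.C F a * KInf.X F ^ k := by
        simp [KInf.ofPoly]
      rw [h2, hX k]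
      change (HahnSeries.C a : LaurentSeries F) * HahnSeries.single (-(k : ℤ)) (1 : F) = _
      rw [HahnSeries.C_apply, HahnSeries.single_mul_single, zero_add, mul_one]
    rw [h1, Polynomial.coeff_monomial]
    change (HahnSeries.single (-(k : ℤ)) a).coeff (-(m : ℤ)) = _
    by_cases h : k = m
    · subst h; simp
    · rw [if_neg h, HahnSeries.coeff_single_of_ne]
      intro h'; apply h; omega

lemma KInf.ofPoly_eq_zero {p : Polynomial F}
    (h : KInf.ofPoly F p ≠ 0 → 0 < (KInf.ofPoly F p).val) : KInf.ofPoly F p = 0 := by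
  by_contra hne
  apply hne
  have : p = 0 := by
    ext m
    rw [← KInf.coeff_ofPoly, Polynomial.coeff_zero]
    refine HahnSeries.coeff_eq_zero_of_lt_order (x := (KInf.ofPoly F p : LaurentSeries F)) ?_
    have := h hne
    simp only [KInf.val] at this
    omega
  rw [this, map_zero]

variable [Finite F]

lemma one_lt_q : (1 : ℝ) < (Nat.card F : ℝ) := by
  exact_mod_cast Finite.one_lt_card

variable (F) in
open Classical in
/-- The absolute value `|a| = k ^ (-v(a))` on `𝔽((X⁻¹))`, where `k` is the number of elements of
the finite field `𝔽`, with `|0| = 0`. -/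
noncomputable def KInf.abs : AbsoluteValue (KInf F) ℝ where
  toFun a := if a = 0 then 0 else (Nat.card F : ℝ) ^ (-a.val)
  map_mul' a b := by
    by_cases ha : a = 0
    · simp [ha]
    by_cases hb : b = 0
    · simp [hb]
    have := one_lt_q (F := F)
    rw [if_neg ha, if_neg hb, if_neg (mul_ne_zero ha hb), KInf.val_mul ha hb, neg_add,
      zpow_add₀ (by positivity)]
  nonneg' a := by
    split_ifs <;> positivity
  eq_zero' a := by
    have := one_lt_q (F := F)
    by_cases ha : a = 0
    · simp [ha]
    · rw [if_neg ha]
      exact iff_of_false (zpow_pos (by linarith) _).ne' ha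
  add_le' a b := by
    have h1 := one_lt_q (F := F)
    by_cases ha : a = 0
    · simp [ha]
    by_cases hb : b = 0
    · simp [hb]
    by_cases hab : a + b = 0
    · simp only [if_neg ha, if_neg hb, if_pos hab]; positivity
    simp only [if_neg ha, if_neg hb, if_neg hab]
    have pa : 0 < (Nat.card F : ℝ) ^ (-a.val) := by positivity
    have pb : 0 < (Nat.card F : ℝ) ^ (-b.val) := by positivity
    rcases min_le_iff.1 (KInf.min_val_le hab) with h | h
    · have := zpow_le_zpow_right₀ h1.le (neg_le_neg h); linarith
    · have := zpow_le_zpow_right₀ h1.le (neg_le_neg h); linarith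

/-- `𝔽((X⁻¹))` with the norm `|a| = k ^ (-v(a))`, the metric `|a - b|` and its topology. -/
noncomputable instance : NormedField (KInf F) := (KInf.abs F).toNormedField

lemma KInf.norm_of_ne {a : KInf F} (h : a ≠ 0) : ‖a‖ = (Nat.card F : ℝ) ^ (-a.val) :=
  if_neg h

lemma KInf.norm_add_le_max (a b : KInf F) : ‖a + b‖ ≤ max ‖a‖ ‖b‖ := by
  have h1 := one_lt_q (F := F)
  by_cases ha : a = 0
  · simp [ha]
  by_cases hb : b = 0
  · simp [hb]
  by_cases hab : a + b = 0
  · rw [hab, norm_zero]; positivity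
  rw [KInf.norm_of_ne ha, KInf.norm_of_ne hb, KInf.norm_of_ne hab, le_max_iff]
  rcases min_le_iff.1 (KInf.min_val_le hab) with h | h
  · exact Or.inl (zpow_le_zpow_right₀ h1.le (neg_le_neg h))
  · exact Or.inr (zpow_le_zpow_right₀ h1.le (neg_le_neg h))

instance : IsUltrametricDist (KInf F) :=
  IsUltrametricDist.isUltrametricDist_of_forall_norm_add_le_max_norm KInf.norm_add_le_max

lemma KInf.ofPoly_eq_zero_of_norm_lt {p : Polynomial F} (h : ‖KInf.ofPoly F p‖ < 1) :
    KInf.ofPoly F p = 0 := by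
  apply KInf.ofPoly_eq_zero
  intro hne
  rw [KInf.norm_of_ne hne] at h
  by_contra hv
  exact absurd h (not_lt.2 (one_le_zpow₀ (one_lt_q (F := F)).le (by omega)))

end Field

section Lattices

variable (F : Type*) [Field F] [Finite F] (m : ℕ)

/-- The group `SL(m, 𝒦)`, `𝒦 = 𝔽((X⁻¹))`, with the topology of matrix entries. -/
abbrev G := Matrix.SpecialLinearGroup (Fin m) (KInf F)

/-- The subgroup `SL(m, 𝔽[X])` of `SL(m, 𝒦)`. -/
noncomputable def Γ : Subgroup (G F m) :=
  (Matrix.SpecialLinearGroup.map (n := Fin m) (KInf.ofPoly F)).range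

/-- The space `Ω_m = SL(m, 𝒦) / SL(m, 𝔽[X])` of unimodular lattices in `𝒦ᵐ`: the coset `g Γ`
stands for the lattice `g 𝔽[X]ᵐ`. -/
abbrev Ω := G F m ⧸ Γ F m

variable {F m}

/-- The maximum of `|Mᵢⱼ - δᵢⱼ|` over the entries of `M`. -/
noncomputable def dev (k : G F m) : ℝ :=
  ‖fun i j => (k : Matrix (Fin m) (Fin m) (KInf F)) i j - (1 : Matrix _ _ (KInf F)) i j‖

/-- The metric on `Ω_m` that comes from the right-invariant metric `min 1 (dev (g h⁻¹))` on
`SL(m, 𝒦)`: the distance of `x` and `y` is the infimum of `dev k` over the `k` with `k x = y`,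
cut off at `1`. -/
noncomputable def latticeDist (x y : Ω F m) : ℝ :=
  min 1 (⨅ k : {k : G F m // k • x = y}, dev k.1)

lemma dev_nonneg (k : G F m) : 0 ≤ dev k := norm_nonneg _

lemma dev_le_iff {k : G F m} {r : ℝ} (hr : 0 ≤ r) :
    dev k ≤ r ↔ ∀ i j, ‖k i j - (1 : Matrix (Fin m) (Fin m) (KInf F)) i j‖ ≤ r := by
  simp only [dev, pi_norm_le_iff_of_nonneg hr]

lemma dev_one : dev (1 : G F m) = 0 := by
  apply le_antisymm _ (dev_nonneg _)
  rw [dev_le_iff le_rfl]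
  simp

lemma norm_sum_le_of_forall {ι : Type*} {s : Finset ι} {f : ι → KInf F} {r : ℝ} (hr : 0 ≤ r)
    (h : ∀ i ∈ s, ‖f i‖ ≤ r) : ‖∑ i ∈ s, f i‖ ≤ r :=
  IsUltrametricDist.norm_sum_le_of_forall_le_of_nonneg hr h

lemma norm_one_entry_le (i j : Fin m) : ‖(1 : Matrix (Fin m) (Fin m) (KInf F)) i j‖ ≤ 1 := by
  rw [Matrix.one_apply]; split_ifs <;> simp

lemma norm_entry_le {k : G F m} (h : dev k ≤ 1) (i j : Fin m) : ‖k i j‖ ≤ 1 := by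
  have h1 := (dev_le_iff zero_le_one).1 h i j
  have h2 := KInf.norm_add_le_max (k i j - (1 : Matrix (Fin m) (Fin m) (KInf F)) i j)
    ((1 : Matrix (Fin m) (Fin m) (KInf F)) i j)
  rw [sub_add_cancel] at h2
  exact h2.trans (max_le h1 (norm_one_entry_le i j))

lemma norm_mul_entry_le {A B : Matrix (Fin m) (Fin m) (KInf F)} {r s : ℝ} (hr : 0 ≤ r)
    (hs : 0 ≤ s) (hA : ∀ i j, ‖A i j‖ ≤ r) (hB : ∀ i j, ‖B i j‖ ≤ s) (i j : Fin m) :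
    ‖(A * B) i j‖ ≤ r * s := by
  rw [Matrix.mul_apply]
  refine norm_sum_le_of_forall (mul_nonneg hr hs) fun l _ => ?_
  rw [norm_mul]
  exact mul_le_mul (hA _ _) (hB _ _) (norm_nonneg _) hr

lemma norm_det_le {A : Matrix (Fin m) (Fin m) (KInf F)} (hA : ∀ i j, ‖A i j‖ ≤ 1) :
    ‖A.det‖ ≤ 1 := by
  rw [Matrix.det_apply']
  refine norm_sum_le_of_forall zero_le_one fun σ _ => ?_
  rw [norm_mul, norm_prod]
  have h1 : ‖((Equiv.Perm.sign σ : ℤ) : KInf F)‖ = 1 := by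
    rcases Int.units_eq_one_or (Equiv.Perm.sign σ) with h | h <;> simp [h]
  rw [h1, one_mul]
  exact Finset.prod_le_one (fun _ _ => norm_nonneg _) fun _ _ => hA _ _

lemma norm_inv_entry_le {k : G F m} (h : dev k ≤ 1) (i j : Fin m) : ‖(k⁻¹) i j‖ ≤ 1 := by
  have : (k⁻¹) i j = (k : Matrix (Fin m) (Fin m) (KInf F)).adjugate i j := by
    rw [Matrix.SpecialLinearGroup.coe_inv]
  rw [this, Matrix.adjugate_apply]
  refine norm_det_le fun a b => ?_
  rw [Matrix.updateRow_apply]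
  split_ifs
  · rw [Pi.single_apply]; split_ifs <;> simp
  · exact norm_entry_le h a b

lemma dev_inv_le {k : G F m} (h : dev k ≤ 1) : dev k⁻¹ ≤ dev k := by
  rw [dev_le_iff (dev_nonneg _)]
  intro i j
  have e : ((k⁻¹ : G F m) : Matrix (Fin m) (Fin m) (KInf F)) - 1 =
      ((k⁻¹ : G F m) : Matrix (Fin m) (Fin m) (KInf F)) * (1 - k) := by
    rw [mul_sub, mul_one, ← Matrix.SpecialLinearGroup.coe_mul, inv_mul_cancel,
      Matrix.SpecialLinearGroup.coe_one]
  have := norm_mul_entry_le (A := ((k⁻¹ : G F m) : Matrix (Fin m) (Fin m) (KInf F)))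
    (B := 1 - (k : Matrix (Fin m) (Fin m) (KInf F))) zero_le_one (dev_nonneg k)
    (norm_inv_entry_le h) (fun a b => by
      rw [Matrix.sub_apply, norm_sub_rev]; exact (dev_le_iff (dev_nonneg k)).1 le_rfl a b) i j
  rw [← e, one_mul, Matrix.sub_apply] at this
  exact this

lemma dev_mul_le {k l : G F m} (hl : dev l ≤ 1) : dev (k * l) ≤ max (dev k) (dev l) := by
  have h0 : 0 ≤ max (dev k) (dev l) := le_max_of_le_left (dev_nonneg k)
  rw [dev_le_iff h0]
  intro i j
  have e : ((k * l : G F m) : Matrix (Fin m) (Fin m) (KInf F)) - 1 =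
      ((k : Matrix (Fin m) (Fin m) (KInf F)) - 1) * (l : Matrix (Fin m) (Fin m) (KInf F))
        + ((l : Matrix (Fin m) (Fin m) (KInf F)) - 1) := by
    rw [Matrix.SpecialLinearGroup.coe_mul, sub_mul, one_mul]; abel
  have h1 := norm_mul_entry_le (A := (k : Matrix (Fin m) (Fin m) (KInf F)) - 1)
    (B := (l : Matrix (Fin m) (Fin m) (KInf F))) (dev_nonneg k) zero_le_one
    (fun a b => (dev_le_iff (dev_nonneg k)).1 le_rfl a b) (norm_entry_le hl) i j
  have h2 := (dev_le_iff (dev_nonneg l)).1 le_rfl i j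
  have h3 := congrFun (congrFun e i) j
  rw [Matrix.sub_apply, Matrix.add_apply, Matrix.sub_apply] at h3
  rw [h3]
  rw [mul_one] at h1
  exact (KInf.norm_add_le_max _ _).trans (max_le_max h1 h2)

lemma latticeDist_nonneg (x y : Ω F m) : 0 ≤ latticeDist x y :=
  le_min zero_le_one (Real.iInf_nonneg fun k => dev_nonneg k.1)

lemma latticeDist_le_one (x y : Ω F m) : latticeDist x y ≤ 1 := min_le_left _ _

lemma latticeDist_le {x y : Ω F m} {k : G F m} (h : k • x = y) : latticeDist x y ≤ dev k := by
  refine (min_le_right _ _).trans ?_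
  exact ciInf_le (f := fun k : {k : G F m // k • x = y} => dev k.1)
    ⟨0, by rintro _ ⟨k, rfl⟩; exact dev_nonneg _⟩ ⟨k, h⟩

lemma exists_of_latticeDist_lt {x y : Ω F m} {r : ℝ} (hr : r ≤ 1) (h : latticeDist x y < r) :
    ∃ k : G F m, k • x = y ∧ dev k < r := by
  obtain ⟨k₀, hk₀⟩ := MulAction.exists_smul_eq (G F m) x y
  have : Nonempty {k : G F m // k • x = y} := ⟨⟨k₀, hk₀⟩⟩
  rcases min_lt_iff.1 h with h | h
  · exact absurd hr (not_le.2 h)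
  · obtain ⟨k, hk⟩ := exists_lt_of_ciInf_lt h
    exact ⟨k.1, k.2, hk⟩

lemma latticeDist_comm_le (x y : Ω F m) : latticeDist y x ≤ latticeDist x y := by
  refine le_of_forall_gt fun r hr => ?_
  by_cases h1 : r ≤ 1
  · obtain ⟨k, hk, hkr⟩ := exists_of_latticeDist_lt h1 hr
    refine (latticeDist_le (k := k⁻¹) ?_).trans_lt
      ((dev_inv_le (hkr.le.trans h1)).trans_lt hkr)
    rw [← hk, inv_smul_smul]
  · exact (latticeDist_le_one _ _).trans_lt (not_le.1 h1)

lemma latticeDist_max (x y z : Ω F m) :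
    latticeDist x z ≤ max (latticeDist x y) (latticeDist y z) := by
  refine le_of_forall_gt fun r hr => ?_
  by_cases h1 : r ≤ 1
  · obtain ⟨k, hk, hkr⟩ := exists_of_latticeDist_lt h1 ((le_max_left _ _).trans_lt hr)
    obtain ⟨l, hl, hlr⟩ := exists_of_latticeDist_lt h1 ((le_max_right _ _).trans_lt hr)
    refine (latticeDist_le (k := l * k) ?_).trans_lt
      ((dev_mul_le (hkr.le.trans h1)).trans_lt (max_lt hlr hkr))
    rw [mul_smul, hk, hl]
  · exact (latticeDist_le_one _ _).trans_lt (not_le.1 h1)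

lemma eq_of_norm_lt_one {a b : G F m} (ha : a ∈ Γ F m) (hb : b ∈ Γ F m)
    (h : ∀ i j, ‖a i j - b i j‖ < 1) : a = b := by
  obtain ⟨a, rfl⟩ := ha
  obtain ⟨b, rfl⟩ := hb
  ext i j
  have := h i j
  simp only [Matrix.SpecialLinearGroup.map_apply_coe, RingHom.mapMatrix_apply,
    Matrix.map_apply] at this ⊢
  rw [← map_sub] at this
  have h0 := KInf.ofPoly_eq_zero_of_norm_lt this
  rwa [map_sub, sub_eq_zero] at h0

lemma exists_entry_bound (A : Matrix (Fin m) (Fin m) (KInf F)) :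
    ∃ r : ℝ, 0 < r ∧ ∀ i j, ‖A i j‖ ≤ r := by
  refine ⟨‖fun i j => A i j‖ + 1, by positivity, fun i j => ?_⟩
  have h1 := norm_le_pi_norm (fun j => A i j) j
  have h2 := norm_le_pi_norm (fun i j => A i j) i
  linarith

lemma exists_eq_of_dev_lt (x y : Ω F m) : ∃ r : ℝ, 0 < r ∧ r ≤ 1 ∧ ∀ k l : G F m,
    k • x = y → l • x = y → dev k < r → dev l < r → k = l := by
  induction x using QuotientGroup.induction_on with | _ g
  induction y using QuotientGroup.induction_on with | _ h
  obtain ⟨a, ha, hga⟩ := exists_entry_bound (g : Matrix (Fin m) (Fin m) (KInf F))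
  obtain ⟨b, hb, hhb⟩ := exists_entry_bound ((h⁻¹ : G F m) : Matrix (Fin m) (Fin m) (KInf F))
  refine ⟨min 1 (b * a)⁻¹, by positivity, min_le_left _ _, fun k l hk hl hkr hlr => ?_⟩
  have hk' : h⁻¹ * (k * g) ∈ Γ F m := QuotientGroup.eq.1 hk.symm
  have hl' : h⁻¹ * (l * g) ∈ Γ F m := QuotientGroup.eq.1 hl.symm
  have key : h⁻¹ * (k * g) = h⁻¹ * (l * g) := by
    refine eq_of_norm_lt_one hk' hl' fun i j => ?_
    set d := max (dev k) (dev l)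
    have hd0 : 0 ≤ d := le_max_of_le_left (dev_nonneg k)
    have hd : d < (b * a)⁻¹ :=
      max_lt (hkr.trans_le (min_le_right _ _)) (hlr.trans_le (min_le_right _ _))
    have hkl : ∀ i j, ‖((k : Matrix (Fin m) (Fin m) (KInf F)) - l) i j‖ ≤ d := by
      intro i j
      have h1 := (dev_le_iff (dev_nonneg k)).1 le_rfl i j
      have h2 := (dev_le_iff (dev_nonneg l)).1 le_rfl i j
      rw [norm_sub_rev] at h2
      have h3 := KInf.norm_add_le_max (k i j - (1 : Matrix (Fin m) (Fin m) (KInf F)) i j)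
        ((1 : Matrix (Fin m) (Fin m) (KInf F)) i j - l i j)
      rw [sub_add_sub_cancel] at h3
      exact h3.trans (max_le_max h1 h2)
    have h4 := norm_mul_entry_le hb.le (by positivity) hhb
      (norm_mul_entry_le hd0 ha.le hkl hga) i j
    have e : ((h⁻¹ : G F m) : Matrix (Fin m) (Fin m) (KInf F)) *
        (((k : Matrix (Fin m) (Fin m) (KInf F)) - l) * (g : Matrix (Fin m) (Fin m) (KInf F))) =
        ((h⁻¹ * (k * g) : G F m) : Matrix (Fin m) (Fin m) (KInf F)) -
          ((h⁻¹ * (l * g) : G F m) : Matrix (Fin m) (Fin m) (KInf F)) := by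
      simp only [Matrix.SpecialLinearGroup.coe_mul, sub_mul, mul_sub]
    rw [e, Matrix.sub_apply] at h4
    refine h4.trans_lt ?_
    calc b * (d * a) = d * (b * a) := by ring
      _ < (b * a)⁻¹ * (b * a) := by gcongr
      _ = 1 := inv_mul_cancel₀ (by positivity)
  exact mul_right_cancel (mul_left_cancel key)

lemma eq_one_of_dev_eq_zero {k : G F m} (h : dev k = 0) : k = 1 := by
  ext i j
  have := (dev_le_iff le_rfl).1 h.le i j
  exact sub_eq_zero.1 (norm_le_zero_iff.1 this)

lemma eq_of_latticeDist_eq_zero {x y : Ω F m} (h : latticeDist x y = 0) : x = y := by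
  obtain ⟨r, hr, hr1, H⟩ := exists_eq_of_dev_lt x y
  obtain ⟨k, hk, hkr⟩ := exists_of_latticeDist_lt hr1 (h.trans_lt hr)
  rcases (dev_nonneg k).eq_or_lt with h0 | h0
  · rw [eq_one_of_dev_eq_zero h0.symm, one_smul] at hk
    exact hk
  · obtain ⟨l, hl, hlr⟩ := exists_of_latticeDist_lt (hkr.le.trans hr1) (h.trans_lt h0)
    have := H k l hk hl hkr (hlr.trans hkr)
    rw [this] at hlr
    exact absurd hlr (lt_irrefl _)

/-- The metric space structure of `latticeDist`, before its topology is identified. -/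
noncomputable abbrev latticeMetric : MetricSpace (Ω F m) where
  dist := latticeDist
  dist_self x := le_antisymm
    ((latticeDist_le (one_smul (G F m) x)).trans_eq dev_one) (latticeDist_nonneg x x)
  dist_comm x y := le_antisymm (latticeDist_comm_le y x) (latticeDist_comm_le x y)
  dist_triangle x y z := (latticeDist_max x y z).trans
    (max_le_add_of_nonneg (latticeDist_nonneg x y) (latticeDist_nonneg y z))
  eq_of_dist_eq_zero := eq_of_latticeDist_eq_zero

lemma nhds_one_hasBasis :
    (nhds (1 : G F m)).HasBasis (fun r : ℝ => 0 < r ∧ r ≤ 1) (fun r => {k | dev k < r}) := by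
  have h1 : nhds (1 : G F m) = Filter.comap
      (fun k : G F m => fun i j => (k : Matrix (Fin m) (Fin m) (KInf F)) i j)
      (nhds fun i j => (1 : Matrix (Fin m) (Fin m) (KInf F)) i j) :=
    nhds_induced _ _
  rw [h1]
  refine (Metric.nhds_basis_ball.comap _).to_hasBasis (fun r hr => ?_) (fun r hr => ?_)
  · refine ⟨min r 1, ⟨by positivity, min_le_right _ _⟩, fun k hk => ?_⟩
    rw [Set.mem_preimage, Metric.mem_ball, dist_eq_norm]
    exact lt_of_lt_of_le hk (min_le_left _ _)
  · refine ⟨r, hr.1, fun k hk => ?_⟩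
    rw [Set.mem_preimage, Metric.mem_ball, dist_eq_norm] at hk
    exact hk

/-- The metric `latticeDist` induces the quotient topology on `SL(m, 𝒦) / SL(m, 𝔽[X])`. -/
lemma quotient_topology_eq :
    (inferInstance : TopologicalSpace (Ω F m)) =
      (latticeMetric (F := F) (m := m)).toUniformSpace.toTopologicalSpace := by
  refine TopologicalSpace.ext_nhds fun x => ?_
  have h1 : nhds x = Filter.map (fun k : G F m => k • x) (nhds 1) := by
    induction x using QuotientGroup.induction_on with | _ g
    have hc : Continuous fun k : G F m => ((k * g : G F m) : Ω F m) :=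
      continuous_quotient_mk'.comp (continuous_mul_const g)
    have ho : IsOpenMap fun k : G F m => ((k * g : G F m) : Ω F m) :=
      QuotientGroup.isOpenMap_coe.comp (isOpenMap_mul_right g)
    have := ho.map_nhds_eq (x := 1) hc.continuousAt
    rw [one_mul] at this
    exact this.symm
  rw [h1]
  refine (nhds_one_hasBasis.map _).ext (@Metric.nhds_basis_ball _
    (latticeMetric (F := F) (m := m)).toPseudoMetricSpace x) ?_ ?_
  · rintro r ⟨hr, hr1⟩
    refine ⟨r, hr, fun y hy => ?_⟩
    obtain ⟨k, hk, hkr⟩ := exists_of_latticeDist_lt hr1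
      ((latticeDist_comm_le y x).trans_lt hy)
    exact ⟨k, hkr, hk⟩
  · intro r hr
    refine ⟨min r 1, ⟨by positivity, min_le_right _ _⟩, ?_⟩
    rintro _ ⟨k, hk, rfl⟩
    exact (latticeDist_comm_le x (k • x)).trans_lt
      ((latticeDist_le rfl).trans_lt (lt_of_lt_of_le hk (min_le_left _ _)))

/-- `Ω_m` as a metric space; its topology is, by definition, the quotient topology. -/
noncomputable instance : MetricSpace (Ω F m) :=
  latticeMetric.replaceTopology quotient_topology_eq

end Lattices

section Flow

variable (F : Type*) [Field F] [Finite F] (n : ℕ)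

/-- `g_t = diag(X^{nt}, X^{-t}, …, X^{-t})` in `SL(n + 1, 𝒦)`. -/
noncomputable def flow (t : ℤ) : G F (n + 1) :=
  ⟨Matrix.diagonal (Fin.cons (KInf.X F ^ (n * t)) fun _ : Fin n => KInf.X F ^ (-t)), by
    rw [Matrix.det_diagonal, Fin.prod_univ_succ]
    simp only [Fin.cons_zero, Fin.cons_succ, Finset.prod_const, Finset.card_univ,
      Fintype.card_fin]
    rw [← zpow_natCast, ← zpow_mul, ← zpow_add₀ KInf.X_ne_zero]
    have : (n : ℤ) * t + -t * n = 0 := by ring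
    rw [this, zpow_zero]⟩

/-- The lattices `Λ` whose trajectory `{g_t Λ | t ∈ ℤ, t ≥ 0}` is bounded, that is, contained in a
compact subset of `Ω_{n+1}`. -/
def Bdd : Set (Ω F (n + 1)) :=
  {Λ | ∃ Q : Set (Ω F (n + 1)), IsCompact Q ∧ ∀ t : ℤ, 0 ≤ t → flow F n t • Λ ∈ Q}

end Flow

end PosChar

/-!
The trajectory of a lattice `g 𝔽[X]^{n+1}` under `g_t` is bounded if and only if the
nonzero vectors of the dual lattices along it are bounded away from `0`. Here only one direction is needed, Mahler's criterion
(`exists_isCompact_of_dual_short_vectors`): a basis of a lattice whose lengths have minimal product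
has linearly independent leading coefficient vectors, hence the product of its lengths is `1`, and
a lower bound on the lengths becomes an upper bound.

Near the identity write `g = p u_x`, where `u_x = [1, x; 0, 1]` is unipotent and `p` is block
lower triangular. Conjugation by `g_t` with `t ≥ 0` does not expand `p`, so that only `x` matters:
the trajectory is bounded if `max (|X^{-nt} w₀|, |X^t (w' - w₀ x)|)` is bounded below, for all
`t ≥ 0` and all nonzero polynomial vectors `(w₀, w')` (`chart_mem_Bdd`). This says that `x` is a
badly approximable vector. The coordinates of `p` and `x` form an isometric chart of `Ω` by a
polydisc of dimension `D = (n + 1)² - 1`, which gives the upper bound `dim Ω ≤ D`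
(`dimH_Ω_le`).

For the lower bound, fix `s` and determine the coordinates in blocks of `L = (n + 1) s` digits, one
block for each time step of length `s`. The dual vectors that may become short during the next
step have norm less than `1`, so that they lie in a hyperplane: a determinant formed from
them would be a nonzero polynomial of absolute value less than `1` (`exists_hyperplane`). They do
stay long if an affine function of the next block avoids a small ball, and at least half of
all blocks have this property, since a change of one digit repairs a bad block
(`NoShortDual.exists_coordinate`). Hence at least `q^{DL-1}` of the `q^{DL}` blocks of
digits can be chosen at each step (`exists_bounded_branches`). Reading a branch of this tree as a
number in base `q^{DL-1}` is a Hölder map onto `[0, 1]` of exponent `D - 1 / L`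
(`le_dimH_range_of_digit_separation`), so that `Bdd` has dimension at least `D - 1 / L`, for
arbitrarily large `L`.
-/

namespace PosChar

/-! ### The absolute value and the topology of `𝔽((X⁻¹))` -/

section Series

variable {F : Type*} [Field F]

lemma KInf.ext_coeff {a b : KInf F} (h : ∀ i, a.coeff i = b.coeff i) : a = b :=
  HahnSeries.ext (funext h)

lemma KInf.coeff_add (a b : KInf F) (i : ℤ) : (a + b).coeff i = a.coeff i + b.coeff i :=
  HahnSeries.coeff_add

lemma KInf.coeff_sub (a b : KInf F) (i : ℤ) : (a - b).coeff i = a.coeff i - b.coeff i :=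
  HahnSeries.coeff_sub

lemma KInf.coeff_zero (i : ℤ) : (0 : KInf F).coeff i = 0 := rfl

variable (F) in
lemma KInf.X_zpow (k : ℤ) :
    (KInf.X F ^ k : KInf F) = (HahnSeries.single (-k) (1 : F) : LaurentSeries F) := by
  have key (m : ℤ) :
      (HahnSeries.single (-1 : ℤ) (1 : F)) ^ m = (HahnSeries.single (-m) (1 : F)) := by
    induction m using Int.induction_on with
    | zero => rfl
    | succ i ih =>
      rw [zpow_add_one₀ (HahnSeries.single_ne_zero one_ne_zero), ih,
        HahnSeries.single_mul_single, one_mul, ← neg_add]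
    | pred i ih =>
      rw [zpow_sub_one₀ (HahnSeries.single_ne_zero one_ne_zero), ih, HahnSeries.inv_single,
        HahnSeries.single_mul_single, inv_one, one_mul]
      rw [show - -(i : ℤ) + - -1 = -(-(i : ℤ) - 1) by ring]
  exact key k

/-- The series `∑ aᵢ X^{-(i+1)}`, an element of the maximal ideal `{|a| < 1}`. -/
noncomputable def ser (a : ℕ → F) : KInf F :=
  HahnSeries.ofSuppBddBelow (fun i : ℤ => if 0 < i then a (i - 1).toNat else 0)
    ⟨0, fun i hi => by
      by_contra h
      exact hi (if_neg (by omega))⟩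

lemma coeff_ser (a : ℕ → F) (i : ℕ) : (ser a).coeff (i + 1) = a i := by
  change (if (0 : ℤ) < i + 1 then a ((i : ℤ) + 1 - 1).toNat else 0) = a i
  rw [if_pos (by omega)]; simp

lemma coeff_ser_of_nonpos (a : ℕ → F) {i : ℤ} (hi : i ≤ 0) : (ser a).coeff i = 0 :=
  if_neg (not_lt.2 hi)

lemma ser_coeff {a : KInf F} (h : ∀ i ≤ 0, a.coeff i = 0) :
    ser (fun i => a.coeff (i + 1)) = a := by
  refine KInf.ext_coeff fun i => ?_
  rcases le_or_gt i 0 with hi | hi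
  · rw [coeff_ser_of_nonpos _ hi, h i hi]
  · obtain ⟨j, rfl⟩ : ∃ j : ℕ, i = j + 1 := ⟨(i - 1).toNat, by omega⟩
    rw [coeff_ser]

lemma ser_add (a b : ℕ → F) : ser (a + b) = ser a + ser b := by
  refine KInf.ext_coeff fun i => ?_
  rw [KInf.coeff_add]
  rcases le_or_gt i 0 with hi | hi
  · simp [coeff_ser_of_nonpos _ hi]
  · obtain ⟨j, rfl⟩ : ∃ j : ℕ, i = j + 1 := ⟨(i - 1).toNat, by omega⟩
    simp [coeff_ser]

lemma ser_single (j : ℕ) : ser (Pi.single j (1 : F)) = KInf.X F ^ (-((j : ℤ) + 1)) := by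
  rw [KInf.X_zpow]
  refine KInf.ext_coeff fun i => ?_
  change _ = (HahnSeries.single (- -((j : ℤ) + 1)) (1 : F)).coeff i
  rw [HahnSeries.coeff_single]
  rcases le_or_gt i 0 with hi | hi
  · rw [coeff_ser_of_nonpos _ hi, if_neg (by omega)]
  · obtain ⟨l, rfl⟩ : ∃ l : ℕ, i = l + 1 := ⟨(i - 1).toNat, by omega⟩
    rw [coeff_ser, Pi.single_apply]
    congr 1
    simp

variable [Finite F]

lemma q_pos : (0 : ℝ) < (Nat.card F : ℝ) := zero_lt_one.trans one_lt_q

variable (F) in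
lemma KInf.norm_X_zpow (k : ℤ) : ‖KInf.X F ^ k‖ = (Nat.card F : ℝ) ^ k := by
  rw [norm_zpow, KInf.norm_of_ne KInf.X_ne_zero]
  congr 1
  change (Nat.card F : ℝ) ^ (- (HahnSeries.single (-1 : ℤ) (1 : F)).order) = _
  rw [HahnSeries.order_single one_ne_zero]; simp

lemma KInf.norm_le_zpow_iff {a : KInf F} {N : ℤ} :
    ‖a‖ ≤ (Nat.card F : ℝ) ^ (-N) ↔ ∀ i < N, a.coeff i = 0 := by
  by_cases ha : a = 0
  · subst ha
    simp only [norm_zero, KInf.coeff_zero, implies_true, iff_true]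
    have := q_pos (F := F)
    positivity
  rw [KInf.norm_of_ne ha, zpow_le_zpow_iff_right₀ one_lt_q, neg_le_neg_iff]
  constructor
  · intro h i hi
    exact HahnSeries.coeff_eq_zero_of_lt_order (x := (a : LaurentSeries F)) (hi.trans_le h)
  · intro h
    by_contra hN
    exact ha ((HahnSeries.coeff_order_eq_zero (x := (a : LaurentSeries F))).1 (h _ (not_le.1 hN)))

/-- The absolute value is discrete: it takes the value `0` and powers of `q`. -/
lemma KInf.norm_le_of_lt {a : KInf F} {N : ℤ} (h : ‖a‖ < (Nat.card F : ℝ) ^ N) :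
    ‖a‖ ≤ (Nat.card F : ℝ) ^ (N - 1) := by
  by_cases ha : a = 0
  · subst ha; rw [norm_zero]
    have := q_pos (F := F)
    positivity
  rw [KInf.norm_of_ne ha] at h ⊢
  rw [zpow_lt_zpow_iff_right₀ one_lt_q] at h
  exact zpow_le_zpow_right₀ one_lt_q.le (by omega)

lemma norm_ser_le (a : ℕ → F) : ‖ser a‖ ≤ (Nat.card F : ℝ) ^ (-1 : ℤ) :=
  KInf.norm_le_zpow_iff.2 fun _ hi => coeff_ser_of_nonpos a (by omega)

variable (F) in
lemma q_inv_lt_one : (Nat.card F : ℝ) ^ (-1 : ℤ) < 1 := by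
  rw [zpow_neg_one]; exact inv_lt_one_of_one_lt₀ one_lt_q

lemma norm_ser_lt_one (a : ℕ → F) : ‖ser a‖ < 1 := (norm_ser_le a).trans_lt (q_inv_lt_one F)

lemma exists_ser_eq {a : KInf F} (h : ‖a‖ < 1) : ∃ f, ser f = a := by
  rw [← zpow_zero (Nat.card F : ℝ)] at h
  have := KInf.norm_le_of_lt h
  rw [zero_sub, KInf.norm_le_zpow_iff] at this
  exact ⟨_, ser_coeff fun i hi => this i (by omega)⟩

lemma norm_ser_sub_le {a b : ℕ → F} {N : ℕ} (h : ∀ i < N, a i = b i) :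
    ‖ser a - ser b‖ ≤ (Nat.card F : ℝ) ^ (-((N : ℤ) + 1)) := by
  rw [KInf.norm_le_zpow_iff]
  intro i hi
  rw [KInf.coeff_sub]
  rcases le_or_gt i 0 with h0 | h0
  · simp [coeff_ser_of_nonpos _ h0]
  · obtain ⟨j, rfl⟩ : ∃ j : ℕ, i = j + 1 := ⟨(i - 1).toNat, by omega⟩
    rw [coeff_ser, coeff_ser, h j (by omega), sub_self]

lemma le_norm_ser_sub {a b : ℕ → F} {N : ℕ} (h : a N ≠ b N) :
    (Nat.card F : ℝ) ^ (-((N : ℤ) + 1)) ≤ ‖ser a - ser b‖ := by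
  by_contra hlt
  have h1 := KInf.norm_le_of_lt (not_le.1 hlt)
  rw [show -((N : ℤ) + 1) - 1 = -((N : ℤ) + 2) by ring, KInf.norm_le_zpow_iff] at h1
  have h2 := h1 (N + 1) (by omega)
  rw [KInf.coeff_sub, coeff_ser, coeff_ser, sub_eq_zero] at h2
  exact h h2

/-- The open unit ball is an image of the compact space of digit sequences. -/
lemma isCompact_ball_one : IsCompact {a : KInf F | ‖a‖ < 1} := by
  let _ : TopologicalSpace F := ⊥
  have : DiscreteTopology F := ⟨rfl⟩
  have hc : Continuous (ser : (ℕ → F) → KInf F) := by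
    rw [continuous_iff_continuousAt]
    intro f
    rw [ContinuousAt, Metric.tendsto_nhds]
    intro ε hε
    obtain ⟨N, hN⟩ := exists_pow_lt_of_lt_one hε (q_inv_lt_one F)
    have hopen : IsOpen (Set.pi (Set.Iio N) fun i => {f i} : Set (ℕ → F)) :=
      isOpen_set_pi (Set.finite_Iio N) fun _ _ => isOpen_discrete _
    filter_upwards [hopen.mem_nhds (x := f) (by simp [Set.mem_pi])] with g hg
    rw [dist_eq_norm]
    refine (norm_ser_sub_le (N := N) fun i hi => hg i hi).trans_lt (lt_of_le_of_lt ?_ hN)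
    rw [← zpow_natCast, ← zpow_mul]
    exact zpow_le_zpow_right₀ one_lt_q.le (by omega)
  have : {a : KInf F | ‖a‖ < 1} = Set.range ser := by
    ext a
    exact ⟨exists_ser_eq, by rintro ⟨f, rfl⟩; exact norm_ser_lt_one f⟩
  rw [this]
  exact isCompact_range hc

instance : ProperSpace (KInf F) := by
  refine ⟨fun x r => ?_⟩
  obtain ⟨N, hN⟩ := pow_unbounded_of_one_lt r (one_lt_q (F := F))
  have hc : Continuous fun a : KInf F => x + KInf.X F ^ (N : ℤ) * a := by fun_prop
  refine (isCompact_ball_one.image hc).of_isClosed_subset Metric.isClosed_closedBall ?_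
  intro y hy
  rw [Metric.mem_closedBall, dist_eq_norm] at hy
  have hX := zpow_ne_zero (N : ℤ) (KInf.X_ne_zero (F := F))
  refine ⟨(KInf.X F ^ (N : ℤ))⁻¹ * (y - x), ?_, ?_⟩
  · rw [Set.mem_ofPred_eq, norm_mul, norm_inv, KInf.norm_X_zpow, zpow_natCast,
      inv_mul_lt_iff₀ (by have := q_pos (F := F); positivity), mul_one]
    exact hy.trans_lt hN
  · simp only
    rw [mul_inv_cancel_left₀ hX, add_sub_cancel]

end Series

/-! ### Hausdorff dimension of sets of digit sequences -/

section Dimension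

open MeasureTheory Measure NNReal ENNReal

/-- If sequences over an alphabet with `M` letters that first differ at the index `k` are mapped to
points at distance at least `c R^{-k}`, the image has dimension at least `log M / log R`: reading
the sequence as a number in base `M` is a Hölder map from the image onto `[0, 1]`. -/
lemma le_dimH_range_of_digit_separation {X : Type*} [MetricSpace X] {M : ℕ} (hM : 1 < M)
    (Φ : (ℕ → Fin M) → X) {c R : ℝ} (hc : 0 < c) (hR : 0 < R)
    (h : ∀ d d' k, (∀ j < k, d j = d' j) → d k ≠ d' k → c * (R ^ k)⁻¹ ≤ dist (Φ d) (Φ d'))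
    {r : ℝ≥0} (hr : 0 < r) (hRM : R ^ (r : ℝ) ≤ M) : (r : ℝ≥0∞) ≤ dimH (Set.range Φ) := by
  have hM0 : (0 : ℝ) < M := by exact_mod_cast zero_lt_one.trans hM
  have first_diff : ∀ d d' : ℕ → Fin M, d ≠ d' →
      ∃ k, (∀ j < k, d j = d' j) ∧ d k ≠ d' k := by
    intro d d' hd
    obtain ⟨k, hk⟩ := Function.ne_iff.1 hd
    classical
    exact ⟨Nat.find ⟨k, hk⟩, fun j hj => not_not.1 (Nat.find_min ⟨k, hk⟩ hj),
      Nat.find_spec (p := fun k => d k ≠ d' k) ⟨k, hk⟩⟩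
  have hinj : Function.Injective Φ := by
    intro d d' hd
    by_contra hne
    obtain ⟨k, hk, hk'⟩ := first_diff d d' hne
    have := h d d' k hk hk'
    rw [hd, dist_self] at this
    exact absurd this (not_le.2 (by positivity))
  have : NeZero M := ⟨by omega⟩
  set g : X → ℝ := fun x => Real.ofDigits (Function.invFun Φ x) with hg
  have hgΦ : ∀ d, g (Φ d) = Real.ofDigits d := fun d => by
    simp only [hg]; rw [Function.leftInverse_invFun hinj]
  have hcr : 0 ≤ (c⁻¹) ^ (r : ℝ) := by positivity
  have hold : HolderOnWith (Real.toNNReal ((c⁻¹) ^ (r : ℝ))) r g (Set.range Φ) := by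
    rintro _ ⟨d, rfl⟩ _ ⟨d', rfl⟩
    by_cases hne : d = d'
    · subst hne; simp
    obtain ⟨k, hk, hk'⟩ := first_diff d d' hne
    rw [hgΦ, hgΦ, edist_dist, edist_dist, ENNReal.ofReal_rpow_of_nonneg dist_nonneg r.coe_nonneg]
    rw [← ENNReal.ofReal, ← ENNReal.ofReal_mul hcr]
    refine ENNReal.ofReal_le_ofReal ?_
    rw [Real.dist_eq, ← Real.mul_rpow (by positivity) dist_nonneg]
    calc |Real.ofDigits d - Real.ofDigits d'| ≤ ((M : ℝ) ^ k)⁻¹ :=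
          Real.abs_ofDigits_sub_ofDigits_le hk
      _ ≤ ((R ^ (r : ℝ)) ^ k)⁻¹ := by gcongr
      _ = ((R ^ k)⁻¹) ^ (r : ℝ) := by
          rw [Real.inv_rpow (by positivity), ← Real.rpow_natCast, ← Real.rpow_natCast,
            ← Real.rpow_mul hR.le, ← Real.rpow_mul hR.le, mul_comm]
      _ ≤ (c⁻¹ * dist (Φ d) (Φ d')) ^ (r : ℝ) := by
          refine Real.rpow_le_rpow (by positivity) ?_ r.coe_nonneg
          rw [le_inv_mul_iff₀ hc]
          exact h d d' k hk hk'
  have h1 := hold.dimH_image_le hr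
  have h2 : Set.Icc (0 : ℝ) 1 ⊆ g '' Set.range Φ := by
    intro y hy
    obtain ⟨d, -, rfl⟩ := Real.ofDigits_SurjOn hM hy
    exact ⟨Φ d, ⟨d, rfl⟩, hgΦ d⟩
  have h3 : dimH (Set.Icc (0 : ℝ) 1) = 1 := by
    rw [Real.dimH_of_nonempty_interior (by simp)]; simp
  have h4 : 1 ≤ dimH (Set.range Φ) / r := h3 ▸ (dimH_mono h2).trans h1
  have hr' : (r : ℝ≥0∞) ≠ 0 := by exact_mod_cast hr.ne'
  rwa [ENNReal.le_div_iff_mul_le (Or.inl hr') (Or.inl ENNReal.coe_ne_top), one_mul] at h4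

variable {F : Type*} [Field F] [Finite F]

/-- The polydisc is covered by `q^{N d}` balls of diameter at most `q^{-N}`. -/
lemma dimH_polydisc_le (ι : Type*) [Fintype ι] :
    dimH {v : ι → KInf F | ∀ i, ‖v i‖ < 1} ≤ (Fintype.card ι : ℝ≥0∞) := by
  classical
  have : Fintype F := Fintype.ofFinite F
  borelize (ι → KInf F)
  set ρ : ℕ → ℝ≥0∞ := fun N => ENNReal.ofReal ((Nat.card F : ℝ) ^ (-(N : ℤ))) with hρ
  have hq := q_pos (F := F)
  set t : ∀ N : ℕ, (ι → Fin N → F) → Set (ι → KInf F) := fun N a =>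
    {v | ∃ f : ι → ℕ → F, (∀ i, v i = ser (f i)) ∧ ∀ i (j : Fin N), f i j = a i j} with ht
  have hdiam : ∀ N a, Metric.ediam (t N a) ≤ ρ N := by
    intro N a
    refine Metric.ediam_le ?_
    rintro v ⟨f, hv, hf⟩ w ⟨g, hw, hg⟩
    rw [edist_dist]
    refine ENNReal.ofReal_le_ofReal ?_
    rw [dist_pi_le_iff (by positivity)]
    intro i
    rw [dist_eq_norm, hv, hw]
    refine (norm_ser_sub_le (N := N) fun j hj => ?_).trans
      (zpow_le_zpow_right₀ one_lt_q.le (by omega))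
    rw [hf i ⟨j, hj⟩, hg i ⟨j, hj⟩]
  have hlim : Filter.Tendsto ρ Filter.atTop (nhds 0) := by
    rw [hρ, ← ENNReal.ofReal_zero]
    refine ENNReal.tendsto_ofReal ?_
    simp only [zpow_neg, zpow_natCast, ← inv_pow]
    exact tendsto_pow_atTop_nhds_zero_of_lt_one (by positivity) (inv_lt_one_of_one_lt₀ one_lt_q)
  have hcover : ∀ N, {v : ι → KInf F | ∀ i, ‖v i‖ < 1} ⊆ ⋃ a, t N a := by
    intro N v hv
    choose f hf using fun i => exists_ser_eq (hv i)
    exact Set.mem_iUnion.2 ⟨fun i j => f i j, f, fun i => (hf i).symm, fun _ _ => rfl⟩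
  have hle := hausdorffMeasure_le_liminf_sum (Fintype.card ι : ℝ)
    {v : ι → KInf F | ∀ i, ‖v i‖ < 1} ρ hlim t (.of_forall hdiam) (.of_forall hcover)
  have hsum : ∀ N, ∑ a, Metric.ediam (t N a) ^ (Fintype.card ι : ℝ) ≤ 1 := by
    intro N
    calc ∑ a, Metric.ediam (t N a) ^ (Fintype.card ι : ℝ)
        ≤ ∑ _a : ι → Fin N → F, ρ N ^ (Fintype.card ι : ℝ) := by
          gcongr with a; exact hdiam N a
      _ = 1 := by
          rw [Finset.sum_const, Finset.card_univ, nsmul_eq_mul, Fintype.card_fun,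
            Fintype.card_fun, Fintype.card_fin, ← Nat.card_eq_fintype_card (α := F),
            ENNReal.rpow_natCast, Nat.cast_pow, ← mul_pow, hρ]
          simp only
          rw [← ENNReal.ofReal_natCast, ← ENNReal.ofReal_mul (by positivity), Nat.cast_pow,
            zpow_neg, zpow_natCast, mul_inv_cancel₀ (by positivity), ENNReal.ofReal_one, one_pow]
  have h1 : μH[(Fintype.card ι : ℝ)] {v : ι → KInf F | ∀ i, ‖v i‖ < 1} ≤ 1 :=
    hle.trans ((Filter.liminf_le_liminf (.of_forall hsum)).trans (by simp))
  have := dimH_le_of_hausdorffMeasure_ne_top (d := (Fintype.card ι : ℝ≥0))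
    (s := {v : ι → KInf F | ∀ i, ‖v i‖ < 1})
    (ne_top_of_le_ne_top ENNReal.one_ne_top (by simpa using h1))
  simpa using this

end Dimension

/-! ### Reduction of bases and Mahler's criterion -/

section Reduction

variable {F : Type*} [Field F] [Finite F] {m : ℕ}

lemma norm_prod_sub_prod_le {ι : Type*} (s : Finset ι) {a b : ι → KInf F} {r : ℝ} (hr : 0 ≤ r)
    (ha : ∀ i, ‖a i‖ ≤ 1) (hb : ∀ i, ‖b i‖ ≤ 1) (h : ∀ i, ‖a i - b i‖ ≤ r) :
    ‖∏ i ∈ s, a i - ∏ i ∈ s, b i‖ ≤ r := by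
  classical
  induction s using Finset.induction_on with
  | empty => simpa using hr
  | insert i s hi ih =>
    rw [Finset.prod_insert hi, Finset.prod_insert hi,
      show a i * ∏ x ∈ s, a x - b i * ∏ x ∈ s, b x =
        a i * (∏ x ∈ s, a x - ∏ x ∈ s, b x) + (a i - b i) * ∏ x ∈ s, b x by ring]
    refine (KInf.norm_add_le_max _ _).trans (max_le ?_ ?_)
    · rw [norm_mul]
      exact (mul_le_of_le_one_left (norm_nonneg _) (ha i)).trans ih
    · rw [norm_mul, norm_prod]
      exact (mul_le_of_le_one_right (norm_nonneg _)
        (Finset.prod_le_one (fun _ _ => norm_nonneg _) fun j _ => hb j)).trans (h i)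

lemma norm_det_sub_det_le {A B : Matrix (Fin m) (Fin m) (KInf F)} {r : ℝ} (hr : 0 ≤ r)
    (hA : ∀ i j, ‖A i j‖ ≤ 1) (hB : ∀ i j, ‖B i j‖ ≤ 1) (h : ∀ i j, ‖A i j - B i j‖ ≤ r) :
    ‖A.det - B.det‖ ≤ r := by
  rw [Matrix.det_apply', Matrix.det_apply', ← Finset.sum_sub_distrib]
  refine norm_sum_le_of_forall hr fun σ _ => ?_
  rw [← mul_sub, norm_mul]
  have h1 : ‖((Equiv.Perm.sign σ : ℤ) : KInf F)‖ = 1 := by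
    rcases Int.units_eq_one_or (Equiv.Perm.sign σ) with h | h <;> simp [h]
  rw [h1, one_mul]
  exact norm_prod_sub_prod_le _ hr (fun i => hA _ _) (fun i => hB _ _) fun i => h _ _

omit [Finite F] in
lemma KInf.coeff_C (a : F) (i : ℤ) : (KInf.C F a).coeff i = if i = 0 then a else 0 := by
  change (HahnSeries.single (0 : ℤ) a).coeff i = _
  rw [HahnSeries.coeff_single]
  congr

lemma KInf.norm_C_of_ne {a : F} (ha : a ≠ 0) : ‖KInf.C F a‖ = 1 := by
  have h : KInf.C F a ≠ 0 := (map_ne_zero _).2 ha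
  rw [KInf.norm_of_ne h]
  change (Nat.card F : ℝ) ^ (-(HahnSeries.single (0 : ℤ) a).order) = 1
  rw [HahnSeries.order_single ha]; simp

lemma KInf.norm_C_le (a : F) : ‖KInf.C F a‖ ≤ 1 := by
  by_cases ha : a = 0
  · simp [ha]
  · exact (KInf.norm_C_of_ne ha).le

lemma KInf.norm_sub_C_coeff_le {a : KInf F} (ha : ‖a‖ ≤ 1) :
    ‖a - KInf.C F (a.coeff 0)‖ ≤ (Nat.card F : ℝ) ^ (-1 : ℤ) := by
  have h := (KInf.norm_le_zpow_iff (a := a) (N := 0)).1 (by simpa using ha)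
  rw [KInf.norm_le_zpow_iff]
  intro i hi
  rw [KInf.coeff_sub, KInf.coeff_C]
  split_ifs with h0
  · rw [h0, sub_self]
  · rw [h i (by omega), sub_zero]

omit [Finite F] in
lemma KInf.ofPoly_C_mul_X_pow (a : F) (k : ℕ) :
    KInf.ofPoly F (Polynomial.C a * Polynomial.X ^ k) = KInf.C F a * KInf.X F ^ k := by
  simp [KInf.ofPoly]

lemma exists_norm_eq_zpow {v : Fin m → KInf F} (hv : v ≠ 0) :
    ∃ d : ℤ, ‖v‖ = (Nat.card F : ℝ) ^ d := by
  obtain ⟨i₀, -⟩ := Function.ne_iff.1 hv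
  have : Nonempty (Fin m) := ⟨i₀⟩
  obtain ⟨i, hi⟩ := Finite.exists_max fun i => ‖v i‖
  have h1 : ‖v‖ = ‖v i‖ :=
    le_antisymm ((pi_norm_le_iff_of_nonneg (norm_nonneg _)).2 hi) (norm_le_pi_norm v i)
  have h2 : v i ≠ 0 := by
    rw [← norm_ne_zero_iff, ← h1, norm_ne_zero_iff]; exact hv
  exact ⟨_, h1.trans (KInf.norm_of_ne h2)⟩

lemma row_ne_zero {R : Type*} [CommRing R] [Nontrivial R]
    (A : Matrix.SpecialLinearGroup (Fin m) R) (i : Fin m) :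
    (A : Matrix (Fin m) (Fin m) R) i ≠ 0 := by
  intro h
  have := Matrix.det_eq_zero_of_row_eq_zero (A := (A : Matrix (Fin m) (Fin m) R)) i
    fun j => congrFun h j
  rw [A.det_coe] at this
  exact one_ne_zero this

/-- If the leading coefficient vectors of the rows are linearly dependent, an elementary row
operation over `𝔽[X]` makes one row shorter and leaves the others alone. -/
lemma exists_shorter_row (A : G F m) (d : Fin m → ℤ)
    (hd : ∀ i, ‖(A : Matrix (Fin m) (Fin m) (KInf F)) i‖ = (Nat.card F : ℝ) ^ d i)
    (hB : (Matrix.of fun i j => (KInf.X F ^ (-d i) * A i j).coeff 0).det = 0) :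
    ∃ γ ∈ Γ F m, ∃ i₀, (∀ i ≠ i₀, (γ * A : G F m).1 i = A.1 i) ∧
      ‖(γ * A : G F m).1 i₀‖ < (Nat.card F : ℝ) ^ d i₀ := by
  have hq := q_pos (F := F)
  obtain ⟨c, hc0, hc⟩ := Matrix.exists_vecMul_eq_zero_iff.2 hB
  obtain ⟨i₀, hi₀, hmax⟩ : ∃ i₀, c i₀ ≠ 0 ∧ ∀ i, c i ≠ 0 → d i ≤ d i₀ := by
    obtain ⟨j, hj⟩ := Function.ne_iff.1 hc0
    obtain ⟨⟨i₀, h1⟩, h2⟩ :=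
      @Finite.exists_max {i // c i ≠ 0} _ _ ⟨⟨j, hj⟩⟩ _ fun i => d i.1
    exact ⟨i₀, h1, fun i hi => h2 ⟨i, hi⟩⟩
  set p : Fin m → Polynomial F := fun j =>
    Polynomial.C (c j / c i₀) * Polynomial.X ^ (d i₀ - d j).toNat with hp
  have hp1 : p i₀ = 1 := by simp [hp, div_self hi₀]
  set E : Matrix.SpecialLinearGroup (Fin m) (Polynomial F) :=
    ⟨Matrix.updateRow 1 i₀ p, by
      rw [← Matrix.cramer_transpose_apply, Matrix.transpose_one, Matrix.cramer_one]
      exact hp1⟩ with hE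
  set γ : G F m := Matrix.SpecialLinearGroup.map (KInf.ofPoly F) E with hγ
  have hrow : ∀ i, (γ * A : G F m).1 i =
      (fun j => KInf.ofPoly F (Matrix.updateRow 1 i₀ p i j)) ᵥ* A.1 := fun i => rfl
  refine ⟨γ, ⟨E, rfl⟩, i₀, fun i hi => ?_, ?_⟩
  · rw [hrow, Matrix.updateRow_ne hi]
    have : (fun j => KInf.ofPoly F ((1 : Matrix (Fin m) (Fin m) (Polynomial F)) i j)) =
        Pi.single i 1 := by
      ext j
      rw [Matrix.one_apply, Pi.single_apply]
      by_cases h : i = j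
      · simp [h]
      · simp [h, Ne.symm h]
    rw [this, Matrix.single_one_vecMul]
    rfl
  · rw [hrow, Matrix.updateRow_self]
    refine lt_of_le_of_lt (b := (Nat.card F : ℝ) ^ (d i₀ - 1)) ?_
      (zpow_lt_zpow_right₀ one_lt_q (by omega))
    rw [pi_norm_le_iff_of_nonneg (by positivity)]
    intro j
    have e : ((fun j => KInf.ofPoly F (p j)) ᵥ* A.1) j =
        KInf.X F ^ d i₀ * ∑ i, KInf.C F (c i / c i₀) * (KInf.X F ^ (-d i) * A i j -
          KInf.C F ((KInf.X F ^ (-d i) * A i j).coeff 0)) := by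
      have h0 : ∑ i, KInf.C F (c i / c i₀) * KInf.C F ((KInf.X F ^ (-d i) * A i j).coeff 0) =
          0 := by
        rw [Finset.sum_congr rfl fun i _ => (map_mul (KInf.C F) (c i / c i₀) _).symm, ← map_sum]
        have := congrFun hc j
        simp only [Matrix.vecMul, dotProduct, Matrix.of_apply, Pi.zero_apply] at this
        simp only [div_mul_eq_mul_div, ← Finset.sum_div]
        rw [this]; simp
      simp only [mul_sub, Finset.sum_sub_distrib]
      rw [h0, mul_zero, sub_zero, Finset.mul_sum]
      change ∑ i, KInf.ofPoly F (p i) * A i j = _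
      refine Finset.sum_congr rfl fun i _ => ?_
      simp only [hp]
      rw [KInf.ofPoly_C_mul_X_pow]
      by_cases hci : c i = 0
      · simp [hci]
      rw [← zpow_natCast, Int.toNat_of_nonneg (by have := hmax i hci; omega),
        zpow_sub₀ KInf.X_ne_zero, zpow_neg]
      ring_nf
    rw [e, norm_mul, KInf.norm_X_zpow, sub_eq_add_neg, zpow_add₀ hq.ne']
    refine mul_le_mul_of_nonneg_left ?_ (by positivity)
    refine norm_sum_le_of_forall (by positivity) fun i _ => ?_
    rw [norm_mul]
    refine (mul_le_of_le_one_left (norm_nonneg _) (KInf.norm_C_le _)).trans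
      (KInf.norm_sub_C_coeff_le ?_)
    rw [norm_mul, KInf.norm_X_zpow, zpow_neg, inv_mul_le_iff₀ (by positivity), mul_one, ← hd i]
    exact norm_le_pi_norm _ j

lemma prod_zpow_eq_zpow_sum {K ι : Type*} [Field K] {x : K} (hx : x ≠ 0) (s : Finset ι)
    (d : ι → ℤ) : ∏ i ∈ s, x ^ d i = x ^ ∑ i ∈ s, d i := by
  classical
  induction s using Finset.induction_on with
  | empty => simp
  | insert i s hi ih => rw [Finset.prod_insert hi, Finset.sum_insert hi, ih, zpow_add₀ hx]

omit [Finite F] in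
lemma det_scaled_rows (A : G F m) (d : Fin m → ℤ) :
    (Matrix.of fun i j => KInf.X F ^ (-d i) * A i j).det = KInf.X F ^ (-∑ i, d i) := by
  have := Matrix.det_mul_column (fun i => KInf.X F ^ (-d i)) A.1
  rw [A.2, mul_one, prod_zpow_eq_zpow_sum KInf.X_ne_zero, Finset.sum_neg_distrib] at this
  exact this

/-- If the leading coefficient vectors of the rows are linearly independent, the product of the
lengths of the rows is at most the absolute value of the determinant. -/
lemma sum_degree_nonpos (A : G F m) (d : Fin m → ℤ)
    (hd : ∀ i, ‖(A : Matrix (Fin m) (Fin m) (KInf F)) i‖ = (Nat.card F : ℝ) ^ d i)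
    (hB : (Matrix.of fun i j => (KInf.X F ^ (-d i) * A i j).coeff 0).det ≠ 0) :
    ∑ i, d i ≤ 0 := by
  have hq := q_pos (F := F)
  set A' : Matrix (Fin m) (Fin m) (KInf F) := Matrix.of fun i j => KInf.X F ^ (-d i) * A i j
  set B : Matrix (Fin m) (Fin m) F := Matrix.of fun i j => (KInf.X F ^ (-d i) * A i j).coeff 0
  have hA' : ∀ i j, ‖A' i j‖ ≤ 1 := by
    intro i j
    change ‖KInf.X F ^ (-d i) * A i j‖ ≤ 1
    rw [norm_mul, KInf.norm_X_zpow, zpow_neg, inv_mul_le_iff₀ (by positivity), mul_one, ← hd i]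
    exact norm_le_pi_norm _ j
  have hdet : A'.det = KInf.X F ^ (-∑ i, d i) := det_scaled_rows A d
  have h1 := norm_det_sub_det_le (A := A') (B := (KInf.C F).mapMatrix B) (by positivity) hA'
    (fun i j => KInf.norm_C_le _) (fun i j => KInf.norm_sub_C_coeff_le (hA' i j))
  rw [← RingHom.map_det] at h1
  by_contra hs
  have h2 : ‖A'.det‖ ≤ (Nat.card F : ℝ) ^ (-1 : ℤ) := by
    rw [hdet, KInf.norm_X_zpow]
    exact zpow_le_zpow_right₀ one_lt_q.le (by omega)
  have h3 := KInf.norm_add_le_max (-(A'.det - KInf.C F B.det)) A'.det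
  rw [norm_neg, neg_sub, sub_add_cancel, KInf.norm_C_of_ne hB] at h3
  exact absurd (h3.trans (max_le h1 h2)) (not_le.2 (q_inv_lt_one F))

/-- A basis for which the product of the lengths is minimal is reduced. -/
lemma exists_reduced_basis (h : G F m) :
    ∃ γ ∈ Γ F m, ∏ i, ‖(γ * h : G F m).1 i‖ ≤ 1 := by
  have hq := q_pos (F := F)
  -- the possible degrees of the product of the lengths
  set S : ℤ → Prop := fun s => ∃ γ ∈ Γ F m, ∃ d : Fin m → ℤ,
    (∀ i, ‖(γ * h : G F m).1 i‖ = (Nat.card F : ℝ) ^ d i) ∧ s = ∑ i, d i with hS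
  have deg : ∀ A : G F m, ∃ d : Fin m → ℤ, ∀ i, ‖A.1 i‖ = (Nat.card F : ℝ) ^ d i := fun A =>
    ⟨_, fun i => (exists_norm_eq_zpow (row_ne_zero A i)).choose_spec⟩
  have hne : ∃ s, S s := by
    obtain ⟨d, hd⟩ := deg (1 * h)
    exact ⟨_, 1, one_mem _, d, hd, rfl⟩
  have hbdd : ∃ b : ℤ, ∀ s, S s → b ≤ s := by
    refine ⟨0, ?_⟩
    rintro s ⟨γ, -, d, hd, rfl⟩
    -- scaling the rows to length one does not make the determinant larger than one
    have h1 : ‖(Matrix.of fun i j => KInf.X F ^ (-d i) * (γ * h : G F m) i j).det‖ ≤ 1 := by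
      refine norm_det_le fun i j => ?_
      rw [Matrix.of_apply, norm_mul, KInf.norm_X_zpow, zpow_neg,
        inv_mul_le_iff₀ (by positivity), mul_one, ← hd i]
      exact norm_le_pi_norm _ j
    rw [det_scaled_rows, KInf.norm_X_zpow] at h1
    by_contra hs
    exact absurd h1 (not_le.2 (one_lt_zpow₀ one_lt_q (by omega)))
  obtain ⟨s, ⟨γ, hγ, d, hd, rfl⟩, hmin⟩ := Int.exists_least_of_bdd hbdd hne
  refine ⟨γ, hγ, ?_⟩
  simp only [hd]
  rw [prod_zpow_eq_zpow_sum hq.ne']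
  refine zpow_le_one_of_nonpos₀ one_lt_q.le (sum_degree_nonpos (γ * h) d hd fun hB => ?_)
  obtain ⟨γ', hγ', i₀, heq, hlt⟩ := exists_shorter_row (γ * h) d hd hB
  obtain ⟨e, he⟩ := deg (γ' * (γ * h))
  have hei : ∀ i ≠ i₀, e i = d i := fun i hi => by
    have := he i
    rw [heq i hi, hd] at this
    exact (zpow_right_injective₀ hq one_lt_q.ne' this).symm
  have hei₀ : e i₀ < d i₀ := by
    rw [he, zpow_lt_zpow_iff_right₀ one_lt_q] at hlt
    exact hlt
  have h1 := hmin (∑ i, e i) ⟨γ' * γ, mul_mem hγ' hγ, e, by rwa [mul_assoc], rfl⟩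
  refine absurd h1 (not_le.2 (Finset.sum_lt_sum (fun i _ => ?_) ⟨i₀, Finset.mem_univ _, hei₀⟩))
  by_cases hi : i = i₀
  · rw [hi]; exact hei₀.le
  · exact (hei i hi).le

/-- Mahler's criterion: the lattices whose dual lattice has no nonzero vector shorter than `δ`
lie in a compact set. The dual lattice of `g 𝔽[X]ᵐ` is `𝔽[X]ᵐ g⁻¹`, with row vectors. -/
lemma exists_isCompact_of_dual_short_vectors (m : ℕ) {δ : ℝ} (hδ : 0 < δ) :
    ∃ Q : Set (Ω F m), IsCompact Q ∧ ∀ g : G F m,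
      (∀ w : Fin m → Polynomial F, w ≠ 0 →
        δ ≤ ‖(fun i => KInf.ofPoly F (w i)) ᵥ* (g⁻¹ : G F m).1‖) → (g : Ω F m) ∈ Q := by
  set δ' : ℝ := min δ 1
  have hδ' : 0 < δ' := by positivity
  set T : Set (G F m) := {A | ∀ i j, ‖A i j‖ ≤ (δ' ^ (m - 1))⁻¹} with hT
  have hTc : IsCompact T := by
    have h1 : IsCompact (Set.pi Set.univ fun _ => Set.pi Set.univ fun _ =>
        Metric.closedBall 0 ((δ' ^ (m - 1))⁻¹) : Set (Matrix (Fin m) (Fin m) (KInf F))) :=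
      isCompact_univ_pi fun _ => isCompact_univ_pi fun _ => isCompact_closedBall _ _
    have h2 : T = ((↑) : G F m → Matrix (Fin m) (Fin m) (KInf F)) ⁻¹'
        (Set.pi Set.univ fun _ => Set.pi Set.univ fun _ =>
          Metric.closedBall 0 ((δ' ^ (m - 1))⁻¹)) := by
      ext A
      exact ⟨fun h i _ j _ => mem_closedBall_zero_iff.2 (h i j),
        fun h i j => mem_closedBall_zero_iff.1 (h i trivial j trivial)⟩
    rw [h2]
    exact Matrix.SpecialLinearGroup.isClosedEmbedding_val.isCompact_preimage h1
  refine ⟨(fun A : G F m => ((A⁻¹ : G F m) : Ω F m)) '' T,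
    hTc.image (continuous_quotient_mk'.comp continuous_inv), fun g hg => ?_⟩
  obtain ⟨γ, hγ, hprod⟩ := exists_reduced_basis (g⁻¹ : G F m)
  refine ⟨γ * g⁻¹, fun i j => ?_, ?_⟩
  · have hrow : ∀ i, δ' ≤ ‖(γ * g⁻¹ : G F m).1 i‖ := by
      intro i
      obtain ⟨P, rfl⟩ := hγ
      exact (min_le_left _ _).trans (hg (P.1 i) (row_ne_zero P i))
    refine (norm_le_pi_norm ((γ * g⁻¹ : G F m).1 i) j).trans ?_
    refine (le_inv_mul_iff₀ (by positivity : 0 < δ' ^ (m - 1))).2 ?_ |>.trans_eq (mul_one _)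
    rw [mul_comm]
    refine le_trans ?_ hprod
    rw [← Finset.mul_prod_erase _ _ (Finset.mem_univ i)]
    refine mul_le_mul_of_nonneg_left ?_ (norm_nonneg _)
    have := Finset.prod_le_prod (s := Finset.univ.erase i) (f := fun _ => δ')
      (g := fun i => ‖(γ * g⁻¹ : G F m).1 i‖) (fun _ _ => hδ'.le) fun i _ => hrow i
    simpa using this
  · change (((γ * g⁻¹)⁻¹ : G F m) : Ω F m) = g
    rw [QuotientGroup.eq, inv_inv, mul_assoc, inv_mul_cancel, mul_one]
    exact hγ

end Reduction

/-! ### A chart of the space of lattices -/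

section Blocks

variable {F : Type*} [Field F] {n : ℕ}

/-- The matrix `[a, r; c, B]` with a corner entry `a`, a row `r`, a column `c` and a square
block `B`. -/
def block {K : Type*} (a : K) (r c : Fin n → K) (B : Matrix (Fin n) (Fin n) K) :
    Matrix (Fin (n + 1)) (Fin (n + 1)) K :=
  Matrix.of (Fin.cons (Fin.cons a r) fun i => Fin.cons (c i) (B i))

section

variable {K : Type*} (a : K) (r c : Fin n → K) (B : Matrix (Fin n) (Fin n) K)

@[simp] lemma block_zero_zero : block a r c B 0 0 = a := rfl
@[simp] lemma block_zero_succ (j : Fin n) : block a r c B 0 j.succ = r j := rfl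
@[simp] lemma block_succ_zero (i : Fin n) : block a r c B i.succ 0 = c i := rfl
@[simp] lemma block_succ_succ (i j : Fin n) : block a r c B i.succ j.succ = B i j := rfl

lemma det_block_zero_row [CommRing K] : (block a 0 c B).det = a * B.det := by
  rw [Matrix.det_succ_row_zero, Fin.sum_univ_succ]
  have : (block a 0 c B).submatrix Fin.succ (Fin.succAbove 0) = B := by
    ext i j
    simp
  simp only [block_zero_succ, Pi.zero_apply, mul_zero, zero_mul, Finset.sum_const_zero, add_zero,
    this]
  simp

lemma det_block_zero_column [CommRing K] : (block a r 0 B).det = a * B.det := by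
  have : (block a r 0 B)ᵀ = block a 0 r Bᵀ := by
    ext i j
    refine Fin.cases ?_ (fun i => ?_) i <;> refine Fin.cases ?_ (fun j => ?_) j <;> simp
  rw [← Matrix.det_transpose, this, det_block_zero_row, Matrix.det_transpose]

end

/-- The unipotent matrix `[1, x; 0, 1]`; these matrices form the group expanded by `g_t`. -/
noncomputable def unip (x : Fin n → KInf F) : G F (n + 1) :=
  ⟨block 1 x 0 1, by rw [det_block_zero_column, Matrix.det_one, mul_one]⟩

lemma coe_unip (x : Fin n → KInf F) :
    (unip x : Matrix (Fin (n + 1)) (Fin (n + 1)) (KInf F)) = block 1 x 0 1 := rfl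

lemma vecMul_unip_zero (w : Fin (n + 1) → KInf F) (x : Fin n → KInf F) :
    (w ᵥ* (unip x : Matrix (Fin (n + 1)) (Fin (n + 1)) (KInf F))) 0 = w 0 := by
  rw [coe_unip, Matrix.vecMul, dotProduct, Fin.sum_univ_succ]
  simp

lemma vecMul_unip_succ (w : Fin (n + 1) → KInf F) (x : Fin n → KInf F) (j : Fin n) :
    (w ᵥ* (unip x : Matrix (Fin (n + 1)) (Fin (n + 1)) (KInf F))) j.succ = w 0 * x j + w j.succ := by
  rw [coe_unip, Matrix.vecMul, dotProduct, Fin.sum_univ_succ]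
  simp [Matrix.one_apply]

lemma mul_unip_zero (A : Matrix (Fin (n + 1)) (Fin (n + 1)) (KInf F)) (x : Fin n → KInf F)
    (i : Fin (n + 1)) : (A * (unip x : Matrix (Fin (n + 1)) (Fin (n + 1)) (KInf F))) i 0 = A i 0 :=
  vecMul_unip_zero (A i) x

lemma mul_unip_succ (A : Matrix (Fin (n + 1)) (Fin (n + 1)) (KInf F)) (x : Fin n → KInf F)
    (i : Fin (n + 1)) (j : Fin n) :
    (A * (unip x : Matrix (Fin (n + 1)) (Fin (n + 1)) (KInf F))) i j.succ = A i 0 * x j + A i j.succ :=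
  vecMul_unip_succ (A i) x j

lemma unip_mul_unip_neg (x : Fin n → KInf F) : unip x * unip (-x) = 1 := by
  ext i j
  rw [Matrix.SpecialLinearGroup.coe_mul]
  refine Fin.cases ?_ (fun j => ?_) j
  · rw [mul_unip_zero]
    refine Fin.cases ?_ (fun i => ?_) i <;> simp [coe_unip]
  · rw [mul_unip_succ]
    refine Fin.cases ?_ (fun i => ?_) i
    · simp [coe_unip, (Fin.succ_ne_zero j).symm]
    · simp [coe_unip, Matrix.one_apply]

/-- The coordinates `(x, c, b)` near the identity of `SL(n + 1, 𝒦)`. -/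
abbrev Coord (n : ℕ) := Fin n ⊕ Fin n ⊕ (Fin n × Fin n)

lemma card_coord (n : ℕ) : Fintype.card (Coord n) = (n + 1) ^ 2 - 1 := by
  simp only [Fintype.card_sum, Fintype.card_prod, Fintype.card_fin]
  have : (n + 1) ^ 2 = n + (n + n * n) + 1 := by ring
  omega

/-- The block `B = 1 + b`. -/
noncomputable def coordBlock (z : Coord n → KInf F) : Matrix (Fin n) (Fin n) (KInf F) :=
  1 + Matrix.of fun i j => z (Sum.inr (Sum.inr (i, j)))

open Classical in
/-- The chart `(x, c, b) ↦ [a, 0; c, B] [1, x; 0, 1]` with `B = 1 + b` and `a = (det B)⁻¹`; the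
first factor is not expanded by `g_t`. (Junk value `1` if `det B = 0`.) -/
noncomputable def chart (z : Coord n → KInf F) : G F (n + 1) :=
  if h : (coordBlock z).det ≠ 0 then
    ⟨block (coordBlock z).det⁻¹ 0 (fun i => z (Sum.inr (Sum.inl i))) (coordBlock z), by
      rw [det_block_zero_row, inv_mul_cancel₀ h]⟩ * unip fun j => z (Sum.inl j)
  else 1

end Blocks

section Chart

variable {F : Type*} [Field F] [Finite F] {n : ℕ}

lemma norm_mul_sub_mul_le {a b a' b' : KInf F} {r : ℝ} (ha : ‖a‖ ≤ 1) (hb' : ‖b'‖ ≤ 1)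
    (h : ‖a - a'‖ ≤ r) (h' : ‖b - b'‖ ≤ r) : ‖a * b - a' * b'‖ ≤ r := by
  rw [show a * b - a' * b' = a * (b - b') + (a - a') * b' by ring]
  refine (KInf.norm_add_le_max _ _).trans (max_le ?_ ?_) <;> rw [norm_mul]
  · exact (mul_le_of_le_one_left (norm_nonneg _) ha).trans h'
  · exact (mul_le_of_le_one_right (norm_nonneg _) hb').trans h

lemma norm_eq_one_of_norm_sub_one_lt {a : KInf F} (h : ‖a - 1‖ < 1) : ‖a‖ = 1 := by
  have h1 := KInf.norm_add_le_max (a - 1) 1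
  have h2 := KInf.norm_add_le_max (-(a - 1)) a
  rw [norm_neg, neg_sub, sub_add_cancel, norm_one] at h2
  rw [sub_add_cancel, norm_one, max_eq_right h.le] at h1
  rcases le_max_iff.1 h2 with h3 | h3
  · exact absurd h3 (not_le.2 h)
  · exact le_antisymm h1 h3

/-- The open unit polydisc, the domain of the chart. -/
def polydisc (F : Type*) [Field F] [Finite F] (ι : Type*) : Set (ι → KInf F) :=
  {z | ∀ i, ‖z i‖ < 1}

lemma norm_coordBlock_sub_le {z z' : Coord n → KInf F} {r : ℝ} (h : ∀ i, ‖z i - z' i‖ ≤ r)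
    (i j : Fin n) : ‖coordBlock z i j - coordBlock z' i j‖ ≤ r := by
  simp only [coordBlock, Matrix.add_apply, Matrix.of_apply, add_sub_add_left_eq_sub]
  exact h _

lemma norm_coordBlock_le {z : Coord n → KInf F} (hz : z ∈ polydisc F (Coord n)) (i j : Fin n) :
    ‖coordBlock z i j‖ ≤ 1 :=
  (KInf.norm_add_le_max _ _).trans (max_le (norm_one_entry_le i j) (hz _).le)

lemma norm_le_of_mem_polydisc {ι : Type*} {z : ι → KInf F} (hz : z ∈ polydisc F ι) (i : ι) :
    ‖z i‖ ≤ (Nat.card F : ℝ) ^ (-1 : ℤ) := by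
  have := hz i
  rw [← zpow_zero (Nat.card F : ℝ)] at this
  simpa using KInf.norm_le_of_lt this

lemma norm_det_coordBlock {z : Coord n → KInf F} (hz : z ∈ polydisc F (Coord n)) :
    ‖(coordBlock z).det‖ = 1 := by
  have hq := q_pos (F := F)
  refine norm_eq_one_of_norm_sub_one_lt (lt_of_le_of_lt ?_ (q_inv_lt_one F))
  rw [← Matrix.det_one (n := Fin n)]
  refine norm_det_sub_det_le (by positivity) (norm_coordBlock_le hz) norm_one_entry_le
    fun i j => ?_
  simp only [coordBlock, Matrix.add_apply, Matrix.of_apply, add_sub_cancel_left]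
  exact norm_le_of_mem_polydisc hz _

lemma det_coordBlock_ne_zero {z : Coord n → KInf F} (hz : z ∈ polydisc F (Coord n)) :
    (coordBlock z).det ≠ 0 := by
  rw [← norm_ne_zero_iff, norm_det_coordBlock hz]
  exact one_ne_zero

section Entries

variable {z : Coord n → KInf F} (hz : z ∈ polydisc F (Coord n))

include hz

lemma chart_eq : ∃ p : G F (n + 1), (p : Matrix (Fin (n + 1)) (Fin (n + 1)) (KInf F)) =
      block (coordBlock z).det⁻¹ 0 (fun i => z (Sum.inr (Sum.inl i))) (coordBlock z) ∧
    chart z = p * unip fun j => z (Sum.inl j) :=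
  ⟨_, rfl, dif_pos (det_coordBlock_ne_zero hz)⟩

lemma chart_zero_zero : chart z 0 0 = (coordBlock z).det⁻¹ := by
  obtain ⟨p, hp, h⟩ := chart_eq hz
  rw [h, Matrix.SpecialLinearGroup.coe_mul, mul_unip_zero, hp, block_zero_zero]

lemma chart_zero_succ (j : Fin n) :
    chart z 0 j.succ = (coordBlock z).det⁻¹ * z (Sum.inl j) := by
  obtain ⟨p, hp, h⟩ := chart_eq hz
  rw [h, Matrix.SpecialLinearGroup.coe_mul, mul_unip_succ, hp]
  simp

lemma chart_succ_zero (i : Fin n) : chart z i.succ 0 = z (Sum.inr (Sum.inl i)) := by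
  obtain ⟨p, hp, h⟩ := chart_eq hz
  rw [h, Matrix.SpecialLinearGroup.coe_mul, mul_unip_zero, hp, block_succ_zero]

lemma chart_succ_succ (i j : Fin n) :
    chart z i.succ j.succ = z (Sum.inr (Sum.inl i)) * z (Sum.inl j) + coordBlock z i j := by
  obtain ⟨p, hp, h⟩ := chart_eq hz
  rw [h, Matrix.SpecialLinearGroup.coe_mul, mul_unip_succ, hp]
  simp

end Entries

/-- The chart does not increase distances, for the maximum norm on matrices. -/
lemma norm_chart_sub_le {z z' : Coord n → KInf F} (hz : z ∈ polydisc F (Coord n))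
    (hz' : z' ∈ polydisc F (Coord n)) {r : ℝ} (hr : 0 ≤ r) (h : ∀ i, ‖z i - z' i‖ ≤ r)
    (i j : Fin (n + 1)) : ‖chart z i j - chart z' i j‖ ≤ r := by
  have ha : ‖(coordBlock z).det⁻¹ - (coordBlock z').det⁻¹‖ ≤ r := by
    rw [inv_sub_inv (det_coordBlock_ne_zero hz) (det_coordBlock_ne_zero hz'), norm_div, norm_mul,
      norm_det_coordBlock hz, norm_det_coordBlock hz', mul_one, div_one, norm_sub_rev]
    exact norm_det_sub_det_le hr (norm_coordBlock_le hz) (norm_coordBlock_le hz')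
      (norm_coordBlock_sub_le h)
  refine Fin.cases ?_ (fun i => ?_) i <;> refine Fin.cases ?_ (fun j => ?_) j
  · rw [chart_zero_zero hz, chart_zero_zero hz']
    exact ha
  · rw [chart_zero_succ hz, chart_zero_succ hz']
    exact norm_mul_sub_mul_le (by rw [norm_inv, norm_det_coordBlock hz, inv_one]) (hz' _).le ha
      (h _)
  · rw [chart_succ_zero hz, chart_succ_zero hz']
    exact h _
  · rw [chart_succ_succ hz, chart_succ_succ hz', add_sub_add_comm]
    exact (KInf.norm_add_le_max _ _).trans (max_le
      (norm_mul_sub_mul_le (hz _).le (hz' _).le (h _) (h _)) (norm_coordBlock_sub_le h i j))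

/-- The chart does not decrease distances: its coordinates can be read off from the matrix by
operations that do not increase distances. -/
lemma norm_sub_le_of_chart {z z' : Coord n → KInf F} (hz : z ∈ polydisc F (Coord n))
    (hz' : z' ∈ polydisc F (Coord n)) {r : ℝ} (h : ∀ i j, ‖chart z i j - chart z' i j‖ ≤ r)
    (i : Coord n) : ‖z i - z' i‖ ≤ r := by
  set a := (coordBlock z).det⁻¹ with ha
  set a' := (coordBlock z').det⁻¹ with ha'
  have na : ‖a‖ = 1 := by rw [ha, norm_inv, norm_det_coordBlock hz, inv_one]
  have na' : ‖a'‖ = 1 := by rw [ha', norm_inv, norm_det_coordBlock hz', inv_one]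
  have haa : ‖a - a'‖ ≤ r := by
    have := h 0 0
    rwa [chart_zero_zero hz, chart_zero_zero hz'] at this
  have hx : ∀ j, ‖z (Sum.inl j) - z' (Sum.inl j)‖ ≤ r := by
    intro j
    have := h 0 j.succ
    rw [chart_zero_succ hz, chart_zero_succ hz', ← ha, ← ha'] at this
    have e : a' * (z (Sum.inl j) - z' (Sum.inl j)) =
        (a * z (Sum.inl j) - a' * z' (Sum.inl j)) + -((a - a') * z (Sum.inl j)) := by ring
    rw [← one_mul ‖z (Sum.inl j) - z' (Sum.inl j)‖, ← na', ← norm_mul, e]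
    refine (KInf.norm_add_le_max _ _).trans (max_le this ?_)
    rw [norm_neg, norm_mul]
    exact (mul_le_of_le_one_right (norm_nonneg _) (hz _).le).trans haa
  have hc : ∀ i, ‖z (Sum.inr (Sum.inl i)) - z' (Sum.inr (Sum.inl i))‖ ≤ r := by
    intro i
    have := h i.succ 0
    rwa [chart_succ_zero hz, chart_succ_zero hz'] at this
  rcases i with j | i | ⟨i, j⟩
  · exact hx j
  · exact hc i
  · have := h i.succ j.succ
    rw [chart_succ_succ hz, chart_succ_succ hz', add_sub_add_comm] at this
    have h2 := norm_mul_sub_mul_le (hz (Sum.inr (Sum.inl i))).le (hz' (Sum.inl j)).le (hc i) (hx j)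
    have h3 := KInf.norm_add_le_max _ _ |>.trans (max_le this ((norm_neg _).trans_le h2))
    rw [add_neg_cancel_comm] at h3
    simpa only [coordBlock, Matrix.add_apply, Matrix.of_apply, add_sub_add_left_eq_sub] using h3

lemma dev_chart_lt_one {z : Coord n → KInf F} (hz : z ∈ polydisc F (Coord n)) :
    dev (chart z) < 1 := by
  have hq := q_pos (F := F)
  have h0 : (0 : Coord n → KInf F) ∈ polydisc F (Coord n) := fun i => by simp
  have h1 : chart (0 : Coord n → KInf F) = 1 := by
    have hB : coordBlock (0 : Coord n → KInf F) = 1 := by ext; simp [coordBlock]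
    ext i j
    refine Fin.cases ?_ (fun i => ?_) i <;> refine Fin.cases ?_ (fun j => ?_) j
    · rw [chart_zero_zero h0, hB]; simp
    · rw [chart_zero_succ h0]; simp [(Fin.succ_ne_zero j).symm]
    · rw [chart_succ_zero h0]; simp
    · rw [chart_succ_succ h0, hB]; simp [Matrix.one_apply]
  refine lt_of_le_of_lt ?_ (q_inv_lt_one F)
  rw [dev_le_iff (by positivity), ← Matrix.SpecialLinearGroup.coe_one, ← h1]
  exact norm_chart_sub_le hz h0 (by positivity) fun i => by
    simpa using norm_le_of_mem_polydisc hz i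

/-- The chart covers a neighborhood of the identity. -/
lemma exists_chart_eq {k : G F (n + 1)} (hk : dev k < 1) :
    ∃ z ∈ polydisc F (Coord n), chart z = k := by
  have hq := q_pos (F := F)
  have hdev := (dev_le_iff (dev_nonneg k)).1 le_rfl
  have ha : ‖k 0 0‖ = 1 :=
    norm_eq_one_of_norm_sub_one_lt ((by simpa using hdev 0 0 : ‖k 0 0 - 1‖ ≤ dev k).trans_lt hk)
  have ha0 : k 0 0 ≠ 0 := by rw [← norm_ne_zero_iff, ha]; exact one_ne_zero
  set x : Fin n → KInf F := fun j => (k 0 0)⁻¹ * k 0 j.succ with hx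
  set z : Coord n → KInf F := Sum.elim x (Sum.elim (fun i => k i.succ 0)
    fun ij => k ij.1.succ ij.2.succ - k ij.1.succ 0 * x ij.2 -
      (1 : Matrix (Fin n) (Fin n) (KInf F)) ij.1 ij.2) with hz
  have hxlt : ∀ j, ‖x j‖ ≤ dev k := fun j => by
    simp only [hx]
    rw [norm_mul, norm_inv, ha, inv_one, one_mul]
    simpa [(Fin.succ_ne_zero j).symm] using hdev 0 j.succ
  have hclt : ∀ i : Fin n, ‖k i.succ 0‖ ≤ dev k := fun i => by
    simpa using hdev i.succ 0
  have hzmem : z ∈ polydisc F (Coord n) := by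
    rintro (j | i | ⟨i, j⟩)
    · exact (hxlt j).trans_lt hk
    · exact (hclt i).trans_lt hk
    · simp only [hz, Sum.elim_inr]
      rw [sub_right_comm, sub_eq_add_neg]
      refine (KInf.norm_add_le_max _ _).trans_lt (max_lt ?_ ?_)
      · have := (hdev i.succ j.succ).trans_lt hk
        simpa [Matrix.one_apply] using this
      · rw [norm_neg, norm_mul]
        exact (mul_le_of_le_one_right (norm_nonneg _) ((hxlt j).trans hk.le)).trans_lt
          ((hclt i).trans_lt hk)
  have hB : ∀ i j, coordBlock z i j = k i.succ j.succ - k i.succ 0 * x j := fun i j => by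
    simp [coordBlock, hz]
  have hp : ((k * unip (-x) : G F (n + 1)) : Matrix (Fin (n + 1)) (Fin (n + 1)) (KInf F)) =
      block (k 0 0) 0 (fun i => k i.succ 0) (coordBlock z) := by
    rw [Matrix.SpecialLinearGroup.coe_mul]
    ext i j
    refine Fin.cases ?_ (fun j => ?_) j
    · rw [mul_unip_zero]
      refine Fin.cases ?_ (fun i => ?_) i <;> rfl
    · rw [mul_unip_succ]
      refine Fin.cases ?_ (fun i => ?_) i
      · simp [hx, mul_inv_cancel_left₀ ha0]
      · rw [block_succ_succ, hB, Pi.neg_apply]; ring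
  have hdet : (coordBlock z).det⁻¹ = k 0 0 := by
    have := (k * unip (-x) : G F (n + 1)).2
    rw [hp, det_block_zero_row] at this
    exact (eq_inv_of_mul_eq_one_left this).symm
  refine ⟨z, hzmem, ?_⟩
  ext i j
  refine Fin.cases ?_ (fun i => ?_) i <;> refine Fin.cases ?_ (fun j => ?_) j
  · rw [chart_zero_zero hzmem, hdet]
  · rw [chart_zero_succ hzmem, hdet]
    exact mul_inv_cancel_left₀ ha0 _
  · rw [chart_succ_zero hzmem]; rfl
  · rw [chart_succ_succ hzmem, hB]
    change k i.succ 0 * x j + _ = _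
    ring

lemma dist_smul_le {m : ℕ} {k l : G F m} (hk : dev k ≤ 1) {r : ℝ} (hr : 0 ≤ r)
    (h : ∀ i j, ‖l i j - k i j‖ ≤ r) (y : Ω F m) : dist (k • y) (l • y) ≤ r := by
  refine (latticeDist_le (k := l * k⁻¹) (by rw [mul_smul, inv_smul_smul])).trans ?_
  rw [dev_le_iff hr]
  intro i j
  have e : ((l * k⁻¹ : G F m) : Matrix (Fin m) (Fin m) (KInf F)) - 1 =
      ((l : Matrix (Fin m) (Fin m) (KInf F)) - (k : Matrix (Fin m) (Fin m) (KInf F))) *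
        ((k⁻¹ : G F m) : Matrix (Fin m) (Fin m) (KInf F)) := by
    rw [sub_mul, ← Matrix.SpecialLinearGroup.coe_mul, ← Matrix.SpecialLinearGroup.coe_mul,
      mul_inv_cancel, Matrix.SpecialLinearGroup.coe_one]
  have := norm_mul_entry_le hr zero_le_one
    (A := (l : Matrix (Fin m) (Fin m) (KInf F)) - (k : Matrix (Fin m) (Fin m) (KInf F)))

    h (norm_inv_entry_le hk) i j
  rw [← e, mul_one] at this
  exact this

/-- Near the identity the projection to `Ω` does not decrease distances, because the identity is
the only element of `SL(m, 𝔽[X])` at distance less than `1` from the identity. -/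
lemma norm_sub_le_dist {m : ℕ} {k l : G F m} (hk : dev k < 1) (hl : dev l < 1) {r : ℝ}
    (hr : r ≤ 1) (h : dist (k : Ω F m) (l : Ω F m) < r) (i j : Fin m) : ‖l i j - k i j‖ < r := by
  obtain ⟨u, hu, hur⟩ := exists_of_latticeDist_lt hr h
  have hγ : l⁻¹ * (u * k) ∈ Γ F m := QuotientGroup.eq.1 hu.symm
  have hdev : dev (l⁻¹ * (u * k)) < 1 := by
    have h1 := dev_mul_le (k := u) hk.le
    have h2 : dev (u * k) < 1 := h1.trans_lt (max_lt (hur.trans_le hr) hk)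
    exact (dev_mul_le h2.le).trans_lt (max_lt ((dev_inv_le hl.le).trans_lt hl) h2)
  have h1 : l⁻¹ * (u * k) = 1 := eq_of_norm_lt_one hγ (one_mem _) fun i j =>
    ((dev_le_iff (dev_nonneg _)).1 le_rfl i j).trans_lt hdev
  have h2 : l = u * k := (inv_mul_eq_one.1 h1)
  have e : (l : Matrix (Fin m) (Fin m) (KInf F)) - k =
      ((u : Matrix (Fin m) (Fin m) (KInf F)) - 1) * k := by
    rw [h2, Matrix.SpecialLinearGroup.coe_mul, sub_mul, one_mul]
  have := norm_mul_entry_le (dev_nonneg u) zero_le_one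
    (A := (u : Matrix (Fin m) (Fin m) (KInf F)) - 1)
    (fun i j => (dev_le_iff (dev_nonneg u)).1 le_rfl i j) (norm_entry_le hk.le) i j
  rw [← e, mul_one] at this
  exact this.trans_lt hur

lemma dist_chart_smul_le {z z' : Coord n → KInf F} (hz : z ∈ polydisc F (Coord n))
    (hz' : z' ∈ polydisc F (Coord n)) (y : Ω F (n + 1)) :
    dist (chart z • y) (chart z' • y) ≤ dist z z' := by
  refine dist_smul_le (dev_chart_lt_one hz).le dist_nonneg (norm_chart_sub_le hz' hz dist_nonneg
    fun i => ?_) y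
  rw [dist_comm, ← dist_eq_norm]
  exact dist_le_pi_dist z' z i

lemma norm_sub_le_dist_chart {z z' : Coord n → KInf F} (hz : z ∈ polydisc F (Coord n))
    (hz' : z' ∈ polydisc F (Coord n)) (i : Coord n) :
    ‖z i - z' i‖ ≤ dist (chart z : Ω F (n + 1)) (chart z' : Ω F (n + 1)) := by
  refine le_of_forall_gt fun r hr => ?_
  by_cases h1 : r ≤ 1
  · have h2 := norm_sub_le_dist (dev_chart_lt_one hz) (dev_chart_lt_one hz') h1 hr
    obtain ⟨p, hp⟩ := Finite.exists_max fun p : Fin (n + 1) × Fin (n + 1) =>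
      ‖chart z p.1 p.2 - chart z' p.1 p.2‖
    refine (norm_sub_le_of_chart hz hz' (fun i j => hp (i, j)) i).trans_lt ?_
    rw [norm_sub_rev]
    exact h2 _ _
  · rw [sub_eq_add_neg]
    refine ((KInf.norm_add_le_max _ _).trans_lt (max_lt (hz i) ?_)).trans (not_le.1 h1)
    rw [norm_neg]; exact hz' i

/-- `Ω` is a countable union of images of the polydisc under Lipschitz maps. -/
lemma dimH_Ω_le : dimH (Set.univ : Set (Ω F (n + 1))) ≤ (((n + 1) ^ 2 - 1 : ℕ) : ENNReal) := by
  have : SecondCountableTopology (Matrix (Fin (n + 1)) (Fin (n + 1)) (KInf F)) :=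
    inferInstanceAs (SecondCountableTopology (Fin (n + 1) → Fin (n + 1) → KInf F))
  have : SecondCountableTopology (G F (n + 1)) :=
    Matrix.SpecialLinearGroup.isClosedEmbedding_val.isEmbedding.secondCountableTopology
  set U : Ω F (n + 1) → Set (Ω F (n + 1)) := fun y =>
    (fun z => chart z • y) '' polydisc F (Coord n) with hU
  have hball : ∀ y, Metric.ball y 1 ⊆ U y := by
    intro y w hw
    obtain ⟨k, rfl, hk1⟩ := exists_of_latticeDist_lt le_rfl (Metric.mem_ball'.1 hw)
    obtain ⟨z, hz, rfl⟩ := exists_chart_eq hk1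
    exact ⟨z, hz, rfl⟩
  obtain ⟨S, hS, hSu⟩ := TopologicalSpace.countable_cover_nhds
    fun y : Ω F (n + 1) => Metric.ball_mem_nhds y one_pos
  have h1 : (Set.univ : Set (Ω F (n + 1))) ⊆ ⋃ y ∈ S, U y := by
    rw [← hSu]
    exact Set.iUnion₂_mono fun y _ => hball y
  refine (dimH_mono h1).trans ?_
  rw [dimH_bUnion hS]
  refine iSup₂_le fun y _ => ?_
  have hlip : LipschitzOnWith 1 (fun z => chart z • y) (polydisc F (Coord n)) :=
    LipschitzOnWith.of_dist_le_mul fun z hz z' hz' => by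
      simpa using dist_chart_smul_le hz hz' y
  refine hlip.dimH_image_le.trans ?_
  rw [← card_coord]
  exact dimH_polydisc_le (Coord n)

end Chart

/-! ### Short vectors of the dual lattices -/

section Dual

variable {F : Type*} [Field F] {n : ℕ}

/-- The image `(X^{-nt} w₀, X^t (w_j - w₀ x_j))` of the row vector `w` under the dual action
`w ↦ w u_x⁻¹ g_t⁻¹`. -/
noncomputable def dualVec (t : ℤ) (x : Fin n → KInf F) (w : Fin (n + 1) → KInf F) :
    Fin (n + 1) → KInf F :=
  Fin.cons (KInf.X F ^ (-(n * t)) * w 0) fun j => KInf.X F ^ t * (w j.succ - w 0 * x j)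

lemma dualVec_zero (t : ℤ) (x : Fin n → KInf F) (w : Fin (n + 1) → KInf F) :
    dualVec t x w 0 = KInf.X F ^ (-(n * t)) * w 0 := rfl

lemma dualVec_succ (t : ℤ) (x : Fin n → KInf F) (w : Fin (n + 1) → KInf F) (j : Fin n) :
    dualVec t x w j.succ = KInf.X F ^ t * (w j.succ - w 0 * x j) := rfl

/-- A change of the time and of the base point, in terms of the vector before the change. -/
lemma dualVec_add_zero (t s : ℤ) (x ξ : Fin n → KInf F) (w : Fin (n + 1) → KInf F) :
    dualVec (t + s) (x + ξ) w 0 = KInf.X F ^ (-(n * s)) * dualVec t x w 0 := by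
  rw [dualVec_zero, dualVec_zero, ← mul_assoc, ← zpow_add₀ KInf.X_ne_zero]
  ring_nf

lemma dualVec_add_succ (t s : ℤ) (x ξ : Fin n → KInf F) (w : Fin (n + 1) → KInf F) (j : Fin n) :
    dualVec (t + s) (x + ξ) w j.succ = KInf.X F ^ s *
      (dualVec t x w j.succ - dualVec t x w 0 * (KInf.X F ^ ((n + 1) * t) * ξ j)) := by
  rw [dualVec_zero, dualVec_succ, dualVec_succ, Pi.add_apply, add_comm t s,
    zpow_add₀ KInf.X_ne_zero, show (n + 1) * t = n * t + t by ring, zpow_add₀ KInf.X_ne_zero,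
    zpow_neg]
  have := zpow_ne_zero (n * t) (KInf.X_ne_zero (F := F))
  field_simp
  ring

lemma coe_flow (t : ℤ) : (flow F n t : Matrix (Fin (n + 1)) (Fin (n + 1)) (KInf F)) =
    Matrix.diagonal (Fin.cons (KInf.X F ^ (n * t)) fun _ : Fin n => KInf.X F ^ (-t)) := rfl

lemma vecMul_unip_neg_mul_flow (t : ℤ) (x : Fin n → KInf F) (w : Fin (n + 1) → KInf F) :
    w ᵥ* ((unip (-x) * flow F n (-t) : G F (n + 1)) :
      Matrix (Fin (n + 1)) (Fin (n + 1)) (KInf F)) = dualVec t x w := by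
  rw [Matrix.SpecialLinearGroup.coe_mul, ← Matrix.vecMul_vecMul, coe_flow]
  ext j
  rw [Matrix.vecMul_diagonal]
  refine Fin.cases ?_ (fun j => ?_) j
  · rw [vecMul_unip_zero, Fin.cons_zero, dualVec_zero, mul_comm, mul_neg]
  · rw [vecMul_unip_succ, Fin.cons_succ, dualVec_succ, mul_comm, neg_neg, Pi.neg_apply]
    ring

variable [Finite F]

/-- At time `t` the dual lattice of `g_t u_x 𝔽[X]^{n+1}` has no nonzero vector shorter than
`δ`. -/
def NoShortDual (δ : ℝ) (t : ℤ) (x : Fin n → KInf F) : Prop :=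
  ∀ w : Fin (n + 1) → Polynomial F, w ≠ 0 → δ ≤ ‖dualVec t x fun i => KInf.ofPoly F (w i)‖

lemma norm_vecMul_le {m : ℕ} {P : Matrix (Fin m) (Fin m) (KInf F)} (hP : ∀ i j, ‖P i j‖ ≤ 1)
    (v : Fin m → KInf F) : ‖v ᵥ* P‖ ≤ ‖v‖ := by
  rw [pi_norm_le_iff_of_nonneg (norm_nonneg _)]
  intro j
  change ‖∑ i, v i * P i j‖ ≤ ‖v‖
  refine norm_sum_le_of_forall (norm_nonneg _) fun i _ => ?_
  rw [norm_mul]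
  exact (mul_le_of_le_one_right (norm_nonneg _) (hP i j)).trans (norm_le_pi_norm v i)

/-- Boundedness of the trajectory depends on the unipotent coordinate `x` only, because conjugation
by `g_t` keeps the other factor of the chart in a compact group. -/
lemma chart_mem_Bdd {z : Coord n → KInf F} (hz : z ∈ polydisc F (Coord n)) {δ : ℝ} (hδ : 0 < δ)
    (h : ∀ t : ℕ, NoShortDual δ t fun j => z (Sum.inl j)) :
    ((chart z : G F (n + 1)) : Ω F (n + 1)) ∈ Bdd F n := by
  have hq := q_pos (F := F)
  obtain ⟨Q, hQ, hmem⟩ := exists_isCompact_of_dual_short_vectors (F := F) (n + 1) hδ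
  refine ⟨Q, hQ, fun t ht => ?_⟩
  lift t to ℕ using ht
  change ((flow F n t * chart z : G F (n + 1)) : Ω F (n + 1)) ∈ Q
  refine hmem _ fun w hw => (h t w hw).trans ?_
  set x : Fin n → KInf F := fun j => z (Sum.inl j)
  obtain ⟨p, hp, hpu⟩ := chart_eq hz
  set P : G F (n + 1) := flow F n t * p * flow F n (-t) with hP
  have hPle : ∀ i j, ‖P i j‖ ≤ 1 := by
    intro i j
    -- conjugation by `g_t` contracts the column `c` and fixes the rest of `p`
    rw [hP, Matrix.SpecialLinearGroup.coe_mul, Matrix.SpecialLinearGroup.coe_mul, coe_flow,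
      coe_flow, Matrix.mul_diagonal, Matrix.diagonal_mul, hp]
    refine Fin.cases ?_ (fun i => ?_) i <;> refine Fin.cases ?_ (fun j => ?_) j
    · simp only [Fin.cons_zero, block_zero_zero, norm_mul, KInf.norm_X_zpow, norm_inv,
        norm_det_coordBlock hz, inv_one, mul_one]
      rw [← zpow_add₀ hq.ne']
      simp
    · simp
    · simp only [Fin.cons_zero, Fin.cons_succ, block_succ_zero, norm_mul, KInf.norm_X_zpow]
      have h1 : (Nat.card F : ℝ) ^ (-(t : ℤ)) ≤ 1 := zpow_le_one_of_nonpos₀ one_lt_q.le (by omega)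
      have h2 : (Nat.card F : ℝ) ^ ((n : ℤ) * -(t : ℤ)) ≤ 1 :=
        zpow_le_one_of_nonpos₀ one_lt_q.le (by rw [mul_neg, neg_nonpos]; positivity)
      exact mul_le_one₀ (mul_le_one₀ h1 (norm_nonneg _) (hz _).le) (by positivity) h2
    · simp only [Fin.cons_succ, block_succ_succ, norm_mul, KInf.norm_X_zpow]
      rw [mul_right_comm, ← zpow_add₀ hq.ne', add_neg_cancel, zpow_zero, one_mul]
      exact norm_coordBlock_le hz i j
  have e : (flow F n t * chart z)⁻¹ * P = unip (-x) * flow F n (-t) := by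
    rw [hpu, hP, inv_mul_eq_iff_eq_mul]
    simp only [mul_assoc]
    rw [← mul_assoc (unip x), unip_mul_unip_neg, one_mul]
  rw [← vecMul_unip_neg_mul_flow, ← e, Matrix.SpecialLinearGroup.coe_mul, ← Matrix.vecMul_vecMul]
  exact norm_vecMul_le hPle _

/-- The vectors of norm less than `1` in a unimodular lattice do not span: a determinant formed
from them is a polynomial of absolute value less than `1`. -/
lemma exists_hyperplane {m : ℕ} (hm : 0 < m) (A : G F m) :
    ∃ a : Fin m → KInf F, a ≠ 0 ∧ ∀ w : Fin m → Polynomial F,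
      ‖(fun i => KInf.ofPoly F (w i)) ᵥ* (A : Matrix (Fin m) (Fin m) (KInf F))‖ < 1 →
      ∑ i, ((fun i => KInf.ofPoly F (w i)) ᵥ* (A : Matrix (Fin m) (Fin m) (KInf F))) i * a i =
        0 := by
  have hq := q_pos (F := F)
  set S : Set (Fin m → KInf F) := {v | ‖v‖ < 1 ∧ ∃ w : Fin m → Polynomial F,
    v = (fun i => KInf.ofPoly F (w i)) ᵥ* (A : Matrix (Fin m) (Fin m) (KInf F))} with hS
  have hspan : Submodule.span (KInf F) S ≠ ⊤ := by
    intro htop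
    obtain ⟨f, hf, -, hli⟩ := Submodule.exists_fun_fin_finrank_span_eq (KInf F) S
    have hr : Module.finrank (KInf F) (Submodule.span (KInf F) S) = m := by
      rw [htop, finrank_top, Module.finrank_fin_fun]
    obtain ⟨f, hf, hli⟩ : ∃ f : Fin m → Fin m → KInf F, (∀ i, f i ∈ S) ∧
        LinearIndependent (KInf F) f := ⟨f ∘ Fin.cast hr.symm, fun i => hf _,
          hli.comp _ (Fin.cast_injective _)⟩
    choose hlt W hW using hf
    have hdet : (Matrix.of f).det = KInf.ofPoly F (Matrix.of W).det := by
      have e : Matrix.of f = (KInf.ofPoly F).mapMatrix (Matrix.of W) *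
          (A : Matrix (Fin m) (Fin m) (KInf F)) := by
        ext i j
        exact congrFun (hW i) j
      rw [e, Matrix.det_mul, A.det_coe, mul_one, RingHom.map_det]
    have hunit : IsUnit (Matrix.of f) := Matrix.linearIndependent_rows_iff_isUnit.1 hli
    have hsmall : ‖(Matrix.of f).det‖ < 1 := by
      have hle : ∀ i j, ‖f i j‖ ≤ (Nat.card F : ℝ) ^ (-1 : ℤ) := fun i j => by
        have := (norm_le_pi_norm (f i) j).trans_lt (hlt i)
        rw [← zpow_zero (Nat.card F : ℝ)] at this
        simpa using KInf.norm_le_of_lt this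
      have h1 := norm_det_sub_det_le (r := (Nat.card F : ℝ) ^ (-1 : ℤ)) (A := Matrix.of f) (B := 0)
        (by positivity)
        (fun i j => (hle i j).trans (q_inv_lt_one F).le) (by simp)
        (fun i j => by rw [Matrix.zero_apply, sub_zero]; exact hle i j)
      have : Nonempty (Fin m) := ⟨⟨0, hm⟩⟩
      rw [Matrix.det_zero, sub_zero] at h1
      exact h1.trans_lt (q_inv_lt_one F)
    rw [Matrix.isUnit_iff_isUnit_det, isUnit_iff_ne_zero] at hunit
    rw [hdet] at hsmall hunit
    exact hunit (KInf.ofPoly_eq_zero_of_norm_lt hsmall)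
  obtain ⟨f, hf0, hf⟩ := Submodule.exists_le_ker_of_lt_top _ (lt_top_iff_ne_top.2 hspan)
  have happ : ∀ v : Fin m → KInf F, f v = ∑ i, v i * f (Pi.single i 1) := fun v => by
    rw [LinearMap.pi_apply_eq_sum_univ f v]
    refine Finset.sum_congr rfl fun i _ => ?_
    rw [smul_eq_mul]
    congr 2
    ext j
    rw [Pi.single_apply]
    simp [eq_comm]
  refine ⟨fun i => f (Pi.single i 1), fun h => hf0 ?_, fun w hw => ?_⟩
  · refine LinearMap.ext fun v => ?_
    rw [happ, LinearMap.zero_apply]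
    exact Finset.sum_eq_zero fun i _ => by rw [congrFun h i, Pi.zero_apply, mul_zero]
  · rw [← happ]
    exact hf (Submodule.subset_span ⟨hw, w, rfl⟩)

lemma norm_add_eq_left {a b : KInf F} (h : ‖b‖ < ‖a‖) : ‖a + b‖ = ‖a‖ := by
  have h1 := KInf.norm_add_le_max a b
  have h2 := KInf.norm_add_le_max (a + b) (-b)
  rw [add_neg_cancel_right, norm_neg] at h2
  rw [max_eq_left h.le] at h1
  rcases le_max_iff.1 h2 with h3 | h3
  · exact le_antisymm h1 h3
  · exact absurd h3 (not_le.2 h)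

/-- The expansion `X^{(n+1)t}` of the entries of `u_ξ` by `g_t` keeps `ξ` small if only its digits
after the first `(n + 1) t` are nonzero. -/
lemma norm_rescaled_le {t : ℤ} {a : KInf F}
    (ha : ‖a‖ ≤ (Nat.card F : ℝ) ^ (-((n + 1) * t + 1))) :
    ‖KInf.X F ^ ((n + 1) * t) * a‖ ≤ (Nat.card F : ℝ) ^ (-1 : ℤ) := by
  have hq := q_pos (F := F)
  rw [norm_mul, KInf.norm_X_zpow]
  refine (mul_le_mul_of_nonneg_left ha (by positivity)).trans_eq ?_
  rw [← zpow_add₀ hq.ne']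
  congr 1
  ring

lemma le_norm_sub_mul {δ : ℝ} {v v₀ y : KInf F} (hv : δ ≤ ‖v‖) (h₀ : ‖v₀‖ < δ) (hy : ‖y‖ ≤ 1) :
    δ ≤ ‖v - v₀ * y‖ := by
  rw [sub_eq_add_neg, norm_add_eq_left]
  · exact hv
  · rw [norm_neg, norm_mul]
    exact ((mul_le_of_le_one_right (norm_nonneg _) hy).trans_lt h₀).trans_le hv

lemma exists_succ_of_le_norm {δ : ℝ} (hδ : 0 < δ) {v : Fin (n + 1) → KInf F} (h : δ ≤ ‖v‖)
    (h₀ : ‖v 0‖ < δ) : ∃ j : Fin n, δ ≤ ‖v j.succ‖ := by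
  by_contra hcon
  push Not at hcon
  refine absurd h (not_le.2 ((pi_norm_lt_iff hδ).2 fun i => ?_))
  exact Fin.cases h₀ hcon i

/-- At time `t` only the first `(n + 1) t` digits of `x` matter. -/
lemma NoShortDual.perturb {δ : ℝ} (hδ : 0 < δ) {t : ℤ} {x ξ : Fin n → KInf F}
    (h : NoShortDual δ t x) (hξ : ∀ j, ‖ξ j‖ ≤ (Nat.card F : ℝ) ^ (-((n + 1) * t + 1))) :
    NoShortDual δ t (x + ξ) := by
  intro w hw
  have h1 := h w hw
  set W := fun i => KInf.ofPoly F (w i)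
  have e0 := dualVec_add_zero t 0 x ξ W
  have e1 := dualVec_add_succ t 0 x ξ W
  simp only [add_zero, mul_zero, neg_zero, zpow_zero, one_mul] at e0 e1
  by_cases h0 : δ ≤ ‖dualVec t x W 0‖
  · rw [← e0] at h0
    exact h0.trans (norm_le_pi_norm _ 0)
  · obtain ⟨j, hj⟩ := exists_succ_of_le_norm hδ h1 (not_le.1 h0)
    refine le_trans ?_ (norm_le_pi_norm _ j.succ)
    rw [e1]
    exact le_norm_sub_mul hj (not_le.1 h0) ((norm_rescaled_le (hξ j)).trans (q_inv_lt_one F).le)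

/-- The flow for a time `r` shrinks vectors by a factor of at most `q^{-nr}`. -/
lemma NoShortDual.add {δ : ℝ} {t : ℤ} {x : Fin n → KInf F} (h : NoShortDual δ t x) (r : ℕ) :
    NoShortDual ((Nat.card F : ℝ) ^ (-((n : ℤ) * r)) * δ) (t + r) x := by
  have hq := q_pos (F := F)
  intro w hw
  refine (mul_le_mul_of_nonneg_left (h w hw) (by positivity)).trans ?_
  set W := fun i => KInf.ofPoly F (w i)
  have e0 := dualVec_add_zero t r x 0 W
  have e1 := dualVec_add_succ t r x 0 W
  simp only [add_zero, Pi.zero_apply, mul_zero, sub_zero] at e0 e1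
  rw [← le_inv_mul_iff₀ (by positivity), pi_norm_le_iff_of_nonneg (by positivity)]
  intro i
  rw [le_inv_mul_iff₀ (by positivity)]
  refine le_trans ?_ (norm_le_pi_norm _ i)
  refine Fin.cases ?_ (fun j => ?_) i
  · rw [e0, norm_mul, KInf.norm_X_zpow]
  · rw [e1, norm_mul, KInf.norm_X_zpow]
    refine mul_le_mul_of_nonneg_right (zpow_le_zpow_right₀ one_lt_q.le ?_) (norm_nonneg _)
    have : 0 ≤ (n : ℤ) * r := by positivity
    omega

/-- If a vector of the dual lattice becomes shorter than `δ = q^{-ns}` between the times `t` and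
`t + s`, it has norm less than `1` at time `t`, so that it lies in the hyperplane orthogonal to
`a`, and its zeroth coordinate is not small. -/
lemma NoShortDual.exists_of_not_add {s : ℕ} {t : ℤ} {x ξ : Fin n → KInf F} {δ : ℝ}
    (hδ : δ = (Nat.card F : ℝ) ^ (-((n : ℤ) * s))) (h : NoShortDual δ t x)
    {a : Fin (n + 1) → KInf F}
    (hperp : ∀ w : Fin (n + 1) → Polynomial F, ‖dualVec t x fun i => KInf.ofPoly F (w i)‖ < 1 →
      ∑ i, dualVec t x (fun i => KInf.ofPoly F (w i)) i * a i = 0)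
    (hξ : ∀ j, ‖ξ j‖ ≤ (Nat.card F : ℝ) ^ (-((n + 1) * t + 1)))
    (hshort : ¬ NoShortDual δ (t + s) (x + ξ)) :
    ∃ v : Fin (n + 1) → KInf F, ∑ i, v i * a i = 0 ∧ δ ≤ ‖v 0‖ ∧
      ∀ j : Fin n, ‖v j.succ - v 0 * (KInf.X F ^ ((n + 1) * t) * ξ j)‖ <
        (Nat.card F : ℝ) ^ (-(s : ℤ)) * δ := by
  have hq := q_pos (F := F)
  have hδ0 : 0 < δ := by rw [hδ]; positivity
  have hδ1 : δ ≤ 1 := by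
    rw [hδ]
    exact zpow_le_one_of_nonpos₀ one_lt_q.le (by rw [neg_nonpos]; positivity)
  simp only [NoShortDual] at hshort
  push Not at hshort
  obtain ⟨w, hw, hlt⟩ := hshort
  set W := fun i => KInf.ofPoly F (w i) with hW
  rw [pi_norm_lt_iff hδ0] at hlt
  have h0 := hlt 0
  have hsucc : ∀ j : Fin n,
      ‖dualVec t x W j.succ - dualVec t x W 0 * (KInf.X F ^ ((n + 1) * t) * ξ j)‖ <
      (Nat.card F : ℝ) ^ (-(s : ℤ)) * δ := by
    intro j
    have := hlt j.succ
    rw [dualVec_add_succ, norm_mul, KInf.norm_X_zpow] at this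
    rw [zpow_neg, lt_inv_mul_iff₀ (by positivity)]
    exact this
  rw [dualVec_add_zero, norm_mul, KInf.norm_X_zpow, ← hδ] at h0
  have h0' : ‖dualVec t x W 0‖ < 1 := by
    by_contra hge
    exact absurd h0 (not_lt.2 (le_mul_of_one_le_right hδ0.le (not_lt.1 hge)))
  have hs1 : (Nat.card F : ℝ) ^ (-(s : ℤ)) ≤ 1 := zpow_le_one_of_nonpos₀ one_lt_q.le (by omega)
  have hyle : ∀ j, ‖(KInf.X F ^ ((n + 1) * t) * ξ j)‖ ≤ 1 := fun j =>
    (norm_rescaled_le (hξ j)).trans (q_inv_lt_one F).le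
  refine ⟨dualVec t x W, hperp w ?_, ?_, hsucc⟩
  · rw [pi_norm_lt_iff one_pos]
    refine Fin.cases h0' fun j => ?_
    rw [← sub_add_cancel (dualVec t x W j.succ) (dualVec t x W 0 * (KInf.X F ^ ((n + 1) * t) * ξ j))]
    refine (KInf.norm_add_le_max _ _).trans_lt (max_lt ?_ ?_)
    · exact (hsucc j).trans_le (mul_le_one₀ hs1 hδ0.le hδ1)
    · rw [norm_mul]
      exact (mul_le_of_le_one_right (norm_nonneg _) (hyle j)).trans_lt h0'
  · by_contra hlt0
    obtain ⟨j, hj⟩ := exists_succ_of_le_norm hδ0 (h w hw) (not_le.1 hlt0)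
    have h1 := le_norm_sub_mul hj (not_le.1 hlt0) (hyle j)
    exact absurd (hsucc j) (not_lt.2 ((mul_le_of_le_one_left hδ0.le hs1).trans h1))
/-- The affine function of the perturbation `ξ` that is small when a vector becomes short. -/
lemma norm_affine_lt {s : ℕ} {δ : ℝ} (hδ0 : 0 < δ)
    {a : Fin (n + 1) → KInf F} {i : Fin n} (hi : ∀ j : Fin n, ‖a j.succ‖ ≤ ‖a i.succ‖)
    (hai : 0 < ‖a i.succ‖) {y : Fin n → KInf F} {v : Fin (n + 1) → KInf F}
    (hv : ∑ i, v i * a i = 0) (hv0 : δ ≤ ‖v 0‖)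
    (hvj : ∀ j : Fin n, ‖v j.succ - v 0 * y j‖ < (Nat.card F : ℝ) ^ (-(s : ℤ)) * δ) :
    ‖a 0 + ∑ j, a j.succ * y j‖ < (Nat.card F : ℝ) ^ (-(s : ℤ)) * ‖a i.succ‖ := by
  have hq := q_pos (F := F)
  set ℓ := a 0 + ∑ j, a j.succ * y j with hℓ
  have e : -(v 0 * ℓ) = ∑ j : Fin n, (v j.succ - v 0 * y j) * a j.succ := by
    rw [Fin.sum_univ_succ] at hv
    simp only [hℓ, sub_mul, Finset.sum_sub_distrib, mul_add, Finset.mul_sum, neg_add]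
    rw [eq_neg_of_add_eq_zero_left hv, neg_neg, sub_eq_add_neg]
    congr 2
    exact Finset.sum_congr rfl fun j _ => by ring
  set ρ := ‖fun j : Fin n => v j.succ - v 0 * y j‖ with hρ
  have hρlt : ρ < (Nat.card F : ℝ) ^ (-(s : ℤ)) * δ :=
    (pi_norm_lt_iff (by positivity)).2 hvj
  have h1 : ‖v 0 * ℓ‖ ≤ ρ * ‖a i.succ‖ := by
    rw [← norm_neg, e]
    refine norm_sum_le_of_forall (by positivity) fun j _ => ?_
    rw [norm_mul]
    exact mul_le_mul (norm_le_pi_norm (fun j : Fin n => v j.succ - v 0 * y j) j) (hi j)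
      (norm_nonneg _) (norm_nonneg _)
  rw [norm_mul] at h1
  by_contra hge
  have h2 : δ * ((Nat.card F : ℝ) ^ (-(s : ℤ)) * ‖a i.succ‖) ≤ ρ * ‖a i.succ‖ :=
    (mul_le_mul hv0 (not_lt.1 hge) (by positivity) (norm_nonneg _)).trans h1
  rw [← mul_assoc] at h2
  have h3 := le_of_mul_le_mul_right h2 hai
  rw [mul_comm] at h3
  exact absurd hρlt (not_lt.2 h3)
omit [Finite F] in
lemma affine_add_single {a : Fin n → KInf F} (t : ℤ) (i : Fin n) (ξ : Fin n → KInf F) :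
    ∑ j, a j * (KInf.X F ^ ((n + 1) * t) *
      (ξ + Pi.single i (KInf.X F ^ (-((n + 1) * t + 1))) : Fin n → KInf F) j) =
    ∑ j, a j * (KInf.X F ^ ((n + 1) * t) * ξ j) + a i * KInf.X F ^ (-1 : ℤ) := by
  have e : KInf.X F ^ ((n + 1) * t) * KInf.X F ^ (-((n + 1) * t + 1)) = KInf.X F ^ (-1 : ℤ) := by
    rw [← zpow_add₀ KInf.X_ne_zero]
    congr 1
    ring
  simp only [Pi.add_apply, mul_add, Finset.sum_add_distrib, Pi.single_apply, mul_ite, mul_zero,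
    Finset.sum_ite_eq', Finset.mem_univ, if_true, e]

/-- The inductive step. Let `δ = q^{-ns}` and let `ξ` range over the perturbations of size
`q^{-(n+1)t-1}`. The vectors that could become shorter than `δ` at time `t + s` have norm less
than `1` at time `t`, so that they lie in a hyperplane; they do stay long as soon as an affine
function of `ξ` that comes from the hyperplane has absolute value at least `q^{-s}`. If this fails
for `ξ`, it holds after a change of the first free digit of one fixed coordinate of `ξ`. -/
lemma NoShortDual.exists_coordinate (hn : 0 < n) {s : ℕ} (hs : 0 < s) {t : ℤ}
    {x : Fin n → KInf F} (h : NoShortDual ((Nat.card F : ℝ) ^ (-((n : ℤ) * s))) t x) :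
    ∃ i : Fin n, ∀ ξ : Fin n → KInf F,
      (∀ j, ‖ξ j‖ ≤ (Nat.card F : ℝ) ^ (-((n + 1) * t + 1))) →
      NoShortDual ((Nat.card F : ℝ) ^ (-((n : ℤ) * s))) (t + s) (x + ξ) ∨
      NoShortDual ((Nat.card F : ℝ) ^ (-((n : ℤ) * s))) (t + s)
        (x + (ξ + Pi.single i (KInf.X F ^ (-((n + 1) * t + 1))))) := by
  have hq := q_pos (F := F)
  set δ := (Nat.card F : ℝ) ^ (-((n : ℤ) * s)) with hδ
  have hδ0 : 0 < δ := by positivity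
  obtain ⟨a, ha, hperp⟩ := exists_hyperplane (Nat.succ_pos n) (unip (-x) * flow F n (-t))
  simp only [vecMul_unip_neg_mul_flow] at hperp
  set y : (Fin n → KInf F) → Fin n → KInf F := fun ξ j => KInf.X F ^ ((n + 1) * t) * ξ j with hy
  by_cases ha' : ∀ j : Fin n, a j.succ = 0
  -- here the hyperplane is `v₀ = 0`, which contains no dangerous vector
  · refine ⟨⟨0, hn⟩, fun ξ hξ => Or.inl ?_⟩
    by_contra hshort
    obtain ⟨v, hv, hv0, -⟩ := h.exists_of_not_add hδ hperp hξ hshort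
    rw [Fin.sum_univ_succ] at hv
    simp only [ha', mul_zero, Finset.sum_const_zero, add_zero, mul_eq_zero] at hv
    rcases hv with hv | hv
    · rw [hv, norm_zero] at hv0
      exact absurd hv0 (not_le.2 hδ0)
    · exact ha (funext fun i => Fin.cases hv ha' i)
  · push Not at ha'
    obtain ⟨j₀, hj₀⟩ := ha'
    have : Nonempty (Fin n) := ⟨j₀⟩
    -- the digit to be changed is that of the largest coefficient of the hyperplane
    obtain ⟨i, hi⟩ := Finite.exists_max fun j : Fin n => ‖a j.succ‖
    have hai : 0 < ‖a i.succ‖ := (norm_pos_iff.2 hj₀).trans_le (hi j₀)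
    set ℓ : (Fin n → KInf F) → KInf F := fun ξ => a 0 + ∑ j, a j.succ * y ξ j with hℓ
    have hsmall : ∀ ξ : Fin n → KInf F,
        (∀ j, ‖ξ j‖ ≤ (Nat.card F : ℝ) ^ (-((n + 1) * t + 1))) →
        ¬ NoShortDual δ (t + s) (x + ξ) →
        ‖ℓ ξ‖ < (Nat.card F : ℝ) ^ (-(s : ℤ)) * ‖a i.succ‖ := by
      intro ξ hξ hshort
      obtain ⟨v, hv, hv0, hvj⟩ := h.exists_of_not_add hδ hperp hξ hshort
      exact norm_affine_lt hδ0 hi hai hv hv0 hvj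
    refine ⟨i, fun ξ hξ => ?_⟩
    by_contra hcon
    push Not at hcon
    set ξ' := ξ + Pi.single i (KInf.X F ^ (-((n + 1) * t + 1))) with hξ'
    have hξ'le : ∀ j, ‖ξ' j‖ ≤ (Nat.card F : ℝ) ^ (-((n + 1) * t + 1)) := by
      intro j
      refine (KInf.norm_add_le_max _ _).trans (max_le (hξ j) ?_)
      rw [Pi.single_apply]
      split_ifs
      · rw [KInf.norm_X_zpow]
      · rw [norm_zero]; positivity
    have h1 := hsmall ξ hξ hcon.1
    have h2 := hsmall ξ' hξ'le hcon.2
    have e : a i.succ * KInf.X F ^ (-1 : ℤ) = ℓ ξ' + -ℓ ξ := by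
      have := affine_add_single (a := fun j : Fin n => a j.succ) t i ξ
      simp only [hℓ, hy, hξ', this]
      ring
    have h3 : ‖a i.succ * KInf.X F ^ (-1 : ℤ)‖ <
        (Nat.card F : ℝ) ^ (-(s : ℤ)) * ‖a i.succ‖ := by
      rw [e]
      refine (KInf.norm_add_le_max _ _).trans_lt (max_lt h2 ?_)
      exact (norm_neg (ℓ ξ)).trans_lt h1
    rw [norm_mul, KInf.norm_X_zpow, mul_comm] at h3
    exact absurd (lt_of_mul_lt_mul_right h3 hai.le)
      (not_lt.2 (zpow_le_zpow_right₀ one_lt_q.le (by omega)))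

end Dual

/-! ### Trees of admissible digits -/

section Tree

/-- If every node of a tree of digit sequences over `A` has at least `M` admissible children, the
sequences over `Fin M` embed in the admissible branches. The predicate `P k f` says that the
first `k` digits of `f` are admissible. -/
lemma exists_branches {A : Type*} {M : ℕ} (P : ℕ → (ℕ → A) → Prop) {f₀ : ℕ → A} (h₀ : P 0 f₀)
    (hstep : ∀ k f, P k f → ∃ e : Fin M → A, Function.Injective e ∧
      ∀ i, P (k + 1) (Function.update f k (e i)))
    (hdep : ∀ k f g, (∀ j < k, f j = g j) → P k f → P k g) :
    ∃ Z : (ℕ → Fin M) → ℕ → A, (∀ d k, P k (Z d)) ∧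
      ∀ d d' k, (∀ j < k, d j = d' j) → d k ≠ d' k → Z d k ≠ Z d' k := by
  classical
  have htotal : ∀ k f, ∃ e : Fin M → A, P k f → Function.Injective e ∧
      ∀ i, P (k + 1) (Function.update f k (e i)) := by
    intro k f
    by_cases h : P k f
    · obtain ⟨e, he⟩ := hstep k f h
      exact ⟨e, fun _ => he⟩
    · exact ⟨fun _ => f 0, fun h' => absurd h' h⟩
  choose e he using htotal
  set st : (ℕ → Fin M) → ℕ → ℕ → A := fun d k =>
    Nat.rec f₀ (fun k f => Function.update f k (e k f (d k))) k with hst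
  have st_succ : ∀ d k, st d (k + 1) = Function.update (st d k) k (e k (st d k) (d k)) :=
    fun d k => rfl
  have hP : ∀ d k, P k (st d k) := by
    intro d k
    induction k with
    | zero => exact h₀
    | succ k ih => rw [st_succ]; exact (he k _ ih).2 _
  have hZ : ∀ d k, st d (k + 1) k = e k (st d k) (d k) := fun d k => by
    rw [st_succ, Function.update_self]
  have hstable : ∀ d k j, j < k → st d k j = st d (j + 1) j := by
    intro d k
    induction k with
    | zero => intro j hj; omega
    | succ k ih =>
      intro j hj
      rcases Nat.lt_succ_iff_lt_or_eq.1 hj with h | rfl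
      · rw [st_succ, Function.update_of_ne h.ne, ih j h]
      · rfl
  refine ⟨fun d k => st d (k + 1) k, fun d k => hdep k _ _ (hstable d k) (hP d k), ?_⟩
  intro d d' k hk hne
  have hagree : ∀ l ≤ k, st d l = st d' l := by
    intro l
    induction l with
    | zero => intro _; rfl
    | succ l ih => intro hl; rw [st_succ, st_succ, ih (by omega), hk l (by omega)]
  simp only [hZ, hagree k le_rfl]
  exact fun h => hne ((he k _ (hP d' k)).1 h)

/-- If every element is in `S` or is moved into `S` by an injective map, `S` contains at least half
of all elements. -/
lemma exists_injective_of_mem_or_mem {A : Type*} [Finite A] {S : Set A} {φ : A → A}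
    (hφ : Function.Injective φ) (h : ∀ a, a ∈ S ∨ φ a ∈ S) {M : ℕ} (hM : 2 * M ≤ Nat.card A) :
    ∃ e : Fin M → A, Function.Injective e ∧ ∀ i, e i ∈ S := by
  have h1 : (Set.univ : Set A) ⊆ S ∪ φ ⁻¹' S := fun a _ => h a
  have h2 : (φ ⁻¹' S).ncard ≤ S.ncard := by
    rw [← Set.ncard_image_of_injective _ hφ]
    exact Set.ncard_le_ncard (Set.image_preimage_subset φ S)
  have h3 := (Set.ncard_le_ncard h1).trans (Set.ncard_union_le _ _)
  rw [Set.ncard_univ] at h3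
  have h4 : M ≤ Nat.card S := by rw [Nat.card_coe_set_eq]; omega
  have := Fintype.ofFinite S
  rw [Nat.card_eq_fintype_card] at h4
  obtain ⟨g⟩ := Function.Embedding.nonempty_of_card_le (α := Fin M) (β := S) (by simpa using h4)
  exact ⟨fun i => g i, Subtype.val_injective.comp g.injective, fun i => (g i).2⟩

end Tree

section Digits

variable {F : Type*} [Field F] {ι : Type*} {L : ℕ} [NeZero L]

/-- The point of the polydisc whose digits, in blocks of length `L`, are given by `f`. -/
noncomputable def digitVal (f : ℕ → ι → Fin L → F) : ι → KInf F :=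
  fun i => ser fun j => f (j / L) i (Fin.ofNat L j)

lemma digitVal_zero : digitVal (0 : ℕ → ι → Fin L → F) = 0 := by
  ext i
  have h := ser_add (0 : ℕ → F) 0
  rw [add_zero, left_eq_add] at h
  exact h

/-- Adding `1` to the first digit of block `k` of one coordinate adds a power of `X` to it. -/
lemma digitVal_update_add [DecidableEq ι] (f : ℕ → ι → Fin L → F) (k : ℕ) (a : ι → Fin L → F)
    (i₀ : ι) : digitVal (Function.update f k (a + Pi.single i₀ (Pi.single 0 1))) =
      digitVal (Function.update f k a) + Pi.single i₀ (KInf.X F ^ (-((L * k : ℤ) + 1))) := by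
  ext i
  have hL := NeZero.pos L
  by_cases hi : i = i₀
  · subst hi
    rw [Pi.add_apply, Pi.single_eq_same, ← Nat.cast_mul, ← ser_single]
    simp only [digitVal]
    rw [← ser_add]
    congr 1
    ext j
    by_cases hk : j / L = k
    · subst hk
      simp only [Function.update_self, Pi.add_apply, Pi.single_eq_same, add_right_inj]
      rw [Pi.single_apply, Pi.single_apply]
      refine if_congr ?_ rfl rfl
      rw [Fin.ext_iff]
      change j % L = 0 % L ↔ _
      have := Nat.div_add_mod j L
      rw [Nat.zero_mod]
      omega
    · simp only [Function.update_of_ne hk, Pi.add_apply]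
      rw [Pi.single_apply, if_neg, add_zero]
      rintro rfl
      exact hk (Nat.mul_div_cancel_left k hL)
  · rw [Pi.add_apply, Pi.single_eq_of_ne hi, add_zero]
    simp only [digitVal]
    congr 1
    ext j
    by_cases hk : j / L = k
    · subst hk
      simp [Pi.single_eq_of_ne hi]
    · simp [Function.update_of_ne hk]

variable [Finite F]

lemma digitVal_mem_polydisc (f : ℕ → ι → Fin L → F) : digitVal f ∈ polydisc F ι :=
  fun _ => norm_ser_lt_one _

lemma norm_digitVal_sub_le {f g : ℕ → ι → Fin L → F} {k : ℕ} (h : ∀ j < k, f j = g j) (i : ι) :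
    ‖digitVal f i - digitVal g i‖ ≤ (Nat.card F : ℝ) ^ (-((L * k : ℤ) + 1)) := by
  rw [← Nat.cast_mul]
  refine norm_ser_sub_le fun j hj => ?_
  rw [h _ (Nat.div_lt_of_lt_mul hj)]

lemma le_norm_digitVal_sub {f g : ℕ → ι → Fin L → F} {k : ℕ} (h : f k ≠ g k) :
    ∃ i, (Nat.card F : ℝ) ^ (-(L * (k + 1) : ℤ)) ≤ ‖digitVal f i - digitVal g i‖ := by
  obtain ⟨i, hi⟩ := Function.ne_iff.1 h
  obtain ⟨l, hl⟩ := Function.ne_iff.1 hi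
  have h1 : (L * k + l) / L = k := by
    rw [Nat.mul_add_div (NeZero.pos L), Nat.div_eq_of_lt l.2, add_zero]
  have h2 : Fin.ofNat L (L * k + l) = l := by
    ext
    change (L * k + l) % L = l
    rw [Nat.mul_add_mod, Nat.mod_eq_of_lt l.2]
  refine ⟨i, le_trans (zpow_le_zpow_right₀ one_lt_q.le ?_)
    (le_norm_ser_sub (N := L * k + l) (by simpa only [h1, h2] using hl))⟩
  have := l.2
  push_cast
  rw [mul_add]
  omega

end Digits

section Main

variable {F : Type*} [Field F] [Finite F] {n : ℕ}

open NNReal ENNReal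

lemma noShortDual_zero {δ : ℝ} (hδ : δ ≤ 1) : NoShortDual δ 0 (0 : Fin n → KInf F) := by
  intro w hw
  obtain ⟨i, hi⟩ := Function.ne_iff.1 hw
  have h1 : (dualVec 0 (0 : Fin n → KInf F) fun i => KInf.ofPoly F (w i)) i =
      KInf.ofPoly F (w i) := by
    refine Fin.cases ?_ (fun j => ?_) i
    · simp [dualVec_zero]
    · simp [dualVec_succ]
  refine hδ.trans (le_trans ?_ (norm_le_pi_norm _ i))
  rw [h1]
  by_contra hlt
  have h2 := KInf.ofPoly_eq_zero_of_norm_lt (not_le.1 hlt)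
  refine hi (Polynomial.ext fun m => ?_)
  rw [← KInf.coeff_ofPoly, h2]
  rfl

/-- A set of points of the polydisc with bounded trajectories, coded by `q^{DL-1}` symbols for
each block of `L` digits of all `D` coordinates. -/
lemma exists_bounded_branches (hn : 0 < n) {s : ℕ} (hs : 0 < s) {L : ℕ} [NeZero L]
    (hL : L = (n + 1) * s) :
    ∃ Z : (ℕ → Fin (Nat.card F ^ (((n + 1) ^ 2 - 1) * L - 1))) → ℕ → Coord n → Fin L → F,
      (∀ d, ((chart (digitVal (Z d)) : G F (n + 1)) : Ω F (n + 1)) ∈ Bdd F n) ∧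
      ∀ d d' k, (∀ j < k, d j = d' j) → d k ≠ d' k → Z d k ≠ Z d' k := by
  have hq := q_pos (F := F)
  set δ := (Nat.card F : ℝ) ^ (-((n : ℤ) * s)) with hδ
  have hδ0 : 0 < δ := by positivity
  set P : ℕ → (ℕ → Coord n → Fin L → F) → Prop := fun k f =>
    NoShortDual δ (s * k) fun j => digitVal f (Sum.inl j) with hPdef
  have hexp : ∀ k : ℕ, (L * k : ℤ) + 1 = (n + 1) * (s * k) + 1 := fun k => by
    rw [hL]; push_cast; ring
  have hzero : P 0 0 := by
    have h0 := noShortDual_zero (F := F) (n := n) (δ := δ)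
      (zpow_le_one_of_nonpos₀ one_lt_q.le (by rw [neg_nonpos]; positivity))
    simp only [hPdef, digitVal_zero, Nat.cast_zero, mul_zero]
    exact h0
  have hstep : ∀ k f, P k f → ∃ e : Fin (Nat.card F ^ (((n + 1) ^ 2 - 1) * L - 1)) →
      Coord n → Fin L → F, Function.Injective e ∧ ∀ i, P (k + 1) (Function.update f k (e i)) := by
    intro k f hf
    obtain ⟨i, hi⟩ := NoShortDual.exists_coordinate hn hs hf
    refine exists_injective_of_mem_or_mem (S := {a | P (k + 1) (Function.update f k a)})
      (φ := fun a => a + Pi.single (Sum.inl i) (Pi.single 0 1)) (add_left_injective _)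
      (fun a => ?_) ?_
    · have h1 := hi (fun j => digitVal (Function.update f k a) (Sum.inl j) -
        digitVal f (Sum.inl j)) fun j => by
          rw [← hexp]
          exact norm_digitVal_sub_le (fun l hl => Function.update_of_ne hl.ne _ _) _
      have ht : (s * (k + 1 : ℕ) : ℤ) = s * k + s := by push_cast; ring
      simp only [hPdef, Set.mem_ofPred_eq, ht]
      refine h1.imp (fun h => ?_) fun h => ?_
      · convert h using 1
        ext j
        simp
      · convert h using 1
        ext j
        rw [digitVal_update_add, hexp]
        simp only [Pi.add_apply, ← add_assoc, add_sub_cancel]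
        congr 1
        simp only [Pi.single_apply, Sum.inl.injEq]
    · have hcard : Nat.card (Coord n → Fin L → F) =
          Nat.card F ^ (((n + 1) ^ 2 - 1) * L) := by
        rw [Nat.card_fun, Nat.card_fun, Nat.card_eq_fintype_card (α := Coord n), card_coord,
          Nat.card_fin, ← pow_mul, mul_comm]
      have hpos : 0 < ((n + 1) ^ 2 - 1) * L := by
        refine Nat.mul_pos ?_ (NeZero.pos L)
        have : 1 < (n + 1) ^ 2 := Nat.one_lt_pow two_ne_zero (by omega)
        omega
      rw [hcard]
      calc 2 * Nat.card F ^ (((n + 1) ^ 2 - 1) * L - 1)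
          ≤ Nat.card F * Nat.card F ^ (((n + 1) ^ 2 - 1) * L - 1) :=
            Nat.mul_le_mul_right _ Finite.one_lt_card
        _ = Nat.card F ^ (((n + 1) ^ 2 - 1) * L) := by
            rw [← pow_succ', Nat.sub_add_cancel hpos]
  have hdep : ∀ k f g, (∀ j < k, f j = g j) → P k f → P k g := by
    intro k f g hfg hf
    have := hf.perturb hδ0 (ξ := fun j => digitVal g (Sum.inl j) - digitVal f (Sum.inl j))
      fun j => by
        rw [← hexp]
        exact norm_digitVal_sub_le (fun l hl => (hfg l hl).symm) _
    convert this using 1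
    ext j
    simp
  obtain ⟨Z, hZ, hsep⟩ := exists_branches P hzero hstep hdep
  refine ⟨Z, fun d => ?_, hsep⟩
  refine chart_mem_Bdd (digitVal_mem_polydisc _) (δ := δ * δ) (by positivity) fun t w hw => ?_
  -- between two multiples of `s` the norms shrink by a factor of at most `q^{-ns}`
  have h1 := (hZ d (t / s)).add (t % s)
  have h2 : ((s : ℤ) * (t / s : ℕ) + (t % s : ℕ)) = t := by exact_mod_cast Nat.div_add_mod t s
  rw [h2] at h1
  refine le_trans (mul_le_mul_of_nonneg_right (zpow_le_zpow_right₀ one_lt_q.le ?_) hδ0.le)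
    (h1 w hw)
  rw [neg_le_neg_iff]
  exact_mod_cast Nat.mul_le_mul_left n (Nat.mod_lt t hs).le

/-- The set of bounded trajectories has full dimension. -/
lemma le_dimH_Bdd (F : Type*) [Field F] [Finite F] (n : ℕ) :
    (((n + 1) ^ 2 - 1 : ℕ) : ℝ≥0∞) ≤ dimH (Bdd F n) := by
  rcases Nat.eq_zero_or_pos n with rfl | hn
  · simp
  have hq := q_pos (F := F)
  set D := (n + 1) ^ 2 - 1 with hD
  have hD2 : 2 ≤ D := by
    have : 2 ^ 2 ≤ (n + 1) ^ 2 := Nat.pow_le_pow_left (by omega) 2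
    omega
  refine ENNReal.le_of_forall_nnreal_lt fun r hr => ?_
  rcases eq_or_ne r 0 with rfl | hr0
  · simp
  have hrD : (r : ℝ) < D := by
    have : r < (D : ℝ≥0) := by exact_mod_cast hr
    exact_mod_cast this
  -- the loss of one digit in each block of length `L` lowers the dimension by `1 / L`
  obtain ⟨s, hs⟩ := exists_nat_gt ((D - r : ℝ)⁻¹)
  have hs0 : 0 < s := by
    have : (0 : ℝ) < s := (inv_pos.2 (sub_pos.2 hrD)).trans hs
    exact_mod_cast this
  set L := (n + 1) * s with hL
  have hLpos : 0 < L := by positivity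
  have : NeZero L := ⟨hLpos.ne'⟩
  have hLr : (L : ℝ) * r ≤ ((D * L - 1 : ℕ) : ℝ) := by
    have h1 : (1 : ℝ) ≤ (D - r) * s := by
      rw [inv_lt_iff_one_lt_mul₀ (sub_pos.2 hrD), mul_comm] at hs
      exact hs.le
    have h2 : (s : ℝ) ≤ L := by
      exact_mod_cast Nat.le_mul_of_pos_left s (Nat.succ_pos n)
    have h3 : (1 : ℝ) ≤ (D - r) * L :=
      h1.trans (mul_le_mul_of_nonneg_left h2 (sub_pos.2 hrD).le)
    rw [Nat.cast_sub (Nat.mul_pos (by omega) hLpos)]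
    push_cast
    linarith
  obtain ⟨Z, hZ, hsep⟩ := exists_bounded_branches (F := F) hn hs0 hL
  refine (le_dimH_range_of_digit_separation (M := Nat.card F ^ (D * L - 1)) ?_
    (fun d => ((chart (digitVal (Z d)) : G F (n + 1)) : Ω F (n + 1)))
    (c := ((Nat.card F : ℝ) ^ L)⁻¹) (R := (Nat.card F : ℝ) ^ L) (by positivity) (by positivity)
    ?_ (pos_iff_ne_zero.2 hr0) ?_).trans (dimH_mono ?_)
  · have : D * 1 ≤ D * L := Nat.mul_le_mul_left D hLpos
    exact Nat.one_lt_pow (by omega) Finite.one_lt_card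
  · intro d d' k hk hne
    obtain ⟨i, hi⟩ := le_norm_digitVal_sub (hsep d d' k hk hne)
    refine le_trans (le_of_eq ?_) (hi.trans (norm_sub_le_dist_chart (digitVal_mem_polydisc _)
      (digitVal_mem_polydisc _) i))
    rw [zpow_neg, ← mul_inv, ← pow_succ', ← pow_mul]
    congr 1
  · rw [← Real.rpow_natCast, ← Real.rpow_mul hq.le, Nat.cast_pow, ← Real.rpow_natCast]
    exact Real.rpow_le_rpow_of_exponent_le one_lt_q.le hLr
  · rintro _ ⟨d, rfl⟩
    exact hZ d

end Main

end PosChar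

theorem mainTheorem8 (F : Type*) [Field F] [Finite F] (n : ℕ) :
    dimH (PosChar.Bdd F n) = dimH (Set.univ : Set (PosChar.Ω F (n + 1))) ∧
      dimH (Set.univ : Set (PosChar.Ω F (n + 1))) = (((n + 1) ^ 2 - 1 : ℕ) : ENNReal) := by
  have h1 := PosChar.le_dimH_Bdd F n
  have h2 := dimH_mono (Set.subset_univ (PosChar.Bdd F n))
  have h3 := PosChar.dimH_Ω_le (F := F) (n := n)
  exact ⟨le_antisymm h2 (h3.trans h1), le_antisymm h3 (h1.trans h2)⟩
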